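/- Setting. Let $N=\{1,\dots,n\}$ with $n\ge 2$, let $\Omega$ be an infinite set of states with a $\sigma$-algebra of events (for instance all subsets of $\Omega$), and let $\mathbb X$ be an infinite set of potential outcomes. A feasible set is a countable $X\subseteq\mathbb X$ with $|X|\ge 2$. An ($X$-valued) act is a measurable function $f:\Omega\to X$ with finite range ($X$ carrying the discrete $\sigma$-algebra); $F_X$ is the set of acts, and outcomes are identified with constant acts. For an event $E$, $xEy$ is the act equal to $x$ on $E$ and to $y$ off $E$. A relation $R_i$ on $F_X$ is an SEU preference if there are a nonconstant bounded $u_i:X\to\mathbb R$ and a countably additive nonatomic probability measure $p_i$ on the events (nonatomic: every event $A$ with $p_i(A)>0$ contains an event $B$ with $0<p_i(B)<p_i(A)$) such that $f\,R_i\,g\iff\int u_i(f)\,dp_i\ge\int u_i(g)\,dp_i$; $p_i$ is unique and $u_i$ is unique up to positive affine transformations. A problem is a pair $(X,R_N)$ where $X$ is a feasible set and $R_N=(R_1,\dots,R_n)$ is a profile of SEU preferences on $F_X$ such that every individual has a best and a worst outcome in $X$. Let $u_i^*(\cdot;X,R_N)$ be the value function normalized so that $\sup_X u_i^*=1$ and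 $\inf_X u_i^*=0$, and $U_i^*(f;X,R_N)=\int u_i^*(f;X,R_N)\,dp_i$, $U^*=(U^*_1,\dots,U^*_n)$. An aggregation rule $\mathbf R$ assigns to each problem a complete and transitive relation $\mathbf R(X,R_N)$ on $F_X$. Asymmetric parts are denoted $P_i$ and $\mathbf P$. Axioms (each for all problems, acts, outcomes and events of the indicated kind). - Pareto principle: if $f R_i g$ for all $i$, then $f\,\mathbf R(X,R_N)\,g$; if $f P_i g$ for all $i$, then $f\,\mathbf P(X,R_N)\,g$. - Continuity: if $U^*(f^t;X,R_N)\to U^*(f;X,R_N)$ for a sequence $(f^t)$ in $F_X$, then $f^t\,\mathbf R(X,R_N)\,g$ for all $t$ implies $f\,\mathbf R(X,R_N)\,g$, and $g\,\mathbf R(X,R_N)\,f^t$ for all $t$ implies $g\,\mathbf R(X,R_N)\,f$. - Independence of inessential expansion (IIE): if $X\subseteq X'$, $R'_N$ coincides with $R_N$ on $F_X$, and for all $x'\in X'$ and $i\in N$ there are $x^+,x^-\in X$ with $x^+R'_i\,x'\,R'_i\,x^-$, then $\mathbf R(X',R'_N)$ coincides with $\mathbf R(X,R_N)$ on $F_X$.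 - Weak preference for mixing: if $x,y\in X$ and $p_i(E)=1/2$ for all $i$, then $xEy\,\mathbf R(X,R_N)\,x$ or $xEy\,\mathbf R(X,R_N)\,y$. - Belief irrelevance: if $u^*(\cdot;X,R_N)=u^*(\cdot;X,R'_N)$, then $x\,\mathbf R(X,R_N)\,y\iff x\,\mathbf R(X,R'_N)\,y$ for all outcomes $x,y\in X$. - Restricted certainty independence: if $u^*_i(\cdot;X,R_N)=u^*_j(\cdot;X,R_N)$ for all $i,j$, then for all $f,g\in F_X$, $x\in X$, $\alpha\in(0,1)$ and all pseudo-mixed acts $f_{\alpha x},g_{\alpha x}$: $f\,\mathbf R(X,R_N)\,g\iff f_{\alpha x}\,\mathbf R(X,R_N)\,g_{\alpha x}$. Here $h$ is a pseudo-mixed act $f_{\alpha x}$ if for all $i$, $p_i(h^{-1}(x))=\alpha p_i(f^{-1}(x))+1-\alpha$ and $p_i(h^{-1}(y))=\alpha p_i(f^{-1}(y))$ for $y\in X\setminus\{x\}$. - Anonymity: $\mathbf R(X,R_N)=\mathbf R(X,R_N^\pi)$ for every permutation $\pi$ of $N$, where $R_i^\pi=R_{\pi(i)}$. Statement. An aggregation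 rule $\mathbf R$ satisfies the Pareto principle, continuity, IIE, weak preference for mixing, belief irrelevance, restricted certainty independence and anonymity if and only if there is a nonempty, closed, convex set $\mathcal M\subseteq\Delta_N=\{\mu\in[0,1]^N:\sum_i\mu_i=1\}$ that is symmetric (if $\mu\in\mathcal M$ then $(\mu_{\pi(1)},\dots,\mu_{\pi(n)})\in\mathcal M$ for every permutation $\pi$ of $N$) and such that for every problem $(X,R_N)$ and all $f,g\in F_X$, $$f\,\mathbf R(X,R_N)\,g\iff\min_{\mu\in\mathcal M}\sum_{i\in N}\mu_iU_i^*(f;X,R_N)\ge\min_{\mu\in\mathcal M}\sum_{i\in N}\mu_iU_i^*(g;X,R_N).$$ -/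

import Mathlib

open MeasureTheory Filter Topology

namespace FairAgg

/-- Feasible sets: countable subsets of the set `O` of potential outcomes with at least two elements. -/
structure FeasibleSet (O : Type*) where
  carrier : Set O
  countable : carrier.Countable
  nontrivial : carrier.Nontrivial

/-- `X`-valued acts: finitely valued functions `Ω → X` all of whose fibres are events. If every
subset of `Ω` is an event, these are all the finitely valued functions. -/
abbrev Act (Ω : Type*) [MeasurableSpace Ω] {O : Type*} (X : FeasibleSet O) : Type _ :=
  SimpleFunc Ω X.carrier

/-- The constant act. -/
abbrev constAct (Ω : Type*) [MeasurableSpace Ω] {O : Type*} {X : FeasibleSet O}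
    (x : X.carrier) : Act Ω X :=
  SimpleFunc.const Ω x

open Classical in
/-- The act `xEy`, equal to `x` on the event `E` and to `y` elsewhere. -/
noncomputable def betAct {Ω : Type*} [MeasurableSpace Ω] {O : Type*} {X : FeasibleSet O}
    (x y : X.carrier) (E : Set Ω) (hE : MeasurableSet E) : Act Ω X :=
  SimpleFunc.piecewise E hE (constAct Ω x) (constAct Ω y)

/-- For `X ⊆ X'`, an `X`-valued act seen as an `X'`-valued act. -/
noncomputable def inclAct {Ω : Type*} [MeasurableSpace Ω] {O : Type*} {X X' : FeasibleSet O}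
    (h : X.carrier ⊆ X'.carrier) (f : Act Ω X) : Act Ω X' :=
  SimpleFunc.map (Set.inclusion h) f

/-- Nonatomic: every event of positive measure contains an event of strictly smaller positive
measure. -/
def Nonatomic {Ω : Type*} [MeasurableSpace Ω] (p : Measure Ω) : Prop :=
  ∀ A, MeasurableSet A → 0 < p A → ∃ B ⊆ A, MeasurableSet B ∧ 0 < p B ∧ p B < p A

/-- The relation `R` on acts is the subjective expected utility preference with nonconstant bounded
value function `u` and countably additive nonatomic belief `p`. -/
structure IsSEURep {Ω : Type*} [MeasurableSpace Ω] {O : Type*} {X : FeasibleSet O}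
    (R : Act Ω X → Act Ω X → Prop) (u : X.carrier → ℝ) (p : Measure Ω) : Prop where
  nonconstant : ∃ x y, u x ≠ u y
  bounded : ∃ C, ∀ x, |u x| ≤ C
  isProbabilityMeasure : IsProbabilityMeasure p
  nonatomic : Nonatomic p
  represents : ∀ f g : Act Ω X, R f g ↔ ∫ ω, u (g ω) ∂p ≤ ∫ ω, u (f ω) ∂p

/-- Profiles of SEU preferences over `X`-valued acts in which every individual has a best and a worst
outcome in `X`. A social choice problem is a feasible set together with such a profile. -/
structure Profile (n : ℕ) (Ω : Type*) [MeasurableSpace Ω] {O : Type*} (X : FeasibleSet O) where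
  pref : Fin n → Act Ω X → Act Ω X → Prop
  isSEU : ∀ i, ∃ u p, IsSEURep (pref i) u p
  best : ∀ i, ∃ b, ∀ x, pref i (constAct Ω b) (constAct Ω x)
  worst : ∀ i, ∃ w, ∀ x, pref i (constAct Ω x) (constAct Ω w)

namespace Profile

variable {n : ℕ} {Ω : Type*} [MeasurableSpace Ω] {O : Type*} {X : FeasibleSet O}

/-- A value function of individual `i`, unique up to positive affine transformations. -/
noncomputable def value (P : Profile n Ω X) (i : Fin n) : X.carrier → ℝ :=
  (P.isSEU i).choose

/-- The belief of individual `i`; it is uniquely determined on events. -/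
noncomputable def belief (P : Profile n Ω X) (i : Fin n) : Measure Ω :=
  (P.isSEU i).choose_spec.choose

/-- The value function of `i`, rescaled so as to have supremum `1` and infimum `0` on `X`. -/
noncomputable def normValue (P : Profile n Ω X) (i : Fin n) (x : X.carrier) : ℝ :=
  (P.value i x - ⨅ y, P.value i y) / ((⨆ y, P.value i y) - ⨅ y, P.value i y)

/-- The 0--1 normalized subjective expected utility of `i`. -/
noncomputable def normSEU (P : Profile n Ω X) (i : Fin n) (f : Act Ω X) : ℝ :=
  ∫ ω, P.normValue i (f ω) ∂(P.belief i)

/-- The profile in which individual `i` has the preference of individual `π i`. -/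
def permute (P : Profile n Ω X) (π : Equiv.Perm (Fin n)) : Profile n Ω X where
  pref i := P.pref (π i)
  isSEU i := P.isSEU (π i)
  best i := P.best (π i)
  worst i := P.worst (π i)

/-- `E` has probability one half according to every individual. -/
def IsCoinToss (P : Profile n Ω X) (E : Set Ω) : Prop :=
  ∀ i, (P.belief i).real E = 1 / 2

open Classical in
/-- `g` is a pseudo-mixed act of `f` and `x` with weight `α` on `f`. -/
def IsPseudoMix (P : Profile n Ω X) (f : Act Ω X) (x : X.carrier) (α : ℝ) (g : Act Ω X) : Prop :=
  ∀ i y, (P.belief i).real (g ⁻¹' {y}) =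
    if y = x then α * (P.belief i).real (f ⁻¹' {y}) + (1 - α)
    else α * (P.belief i).real (f ⁻¹' {y})

/-- The problem `(X', P')` is an inessential expansion of `(X, P)`. -/
def IsInessentialExpansion {X' : FeasibleSet O} (P : Profile n Ω X) (P' : Profile n Ω X')
    (h : X.carrier ⊆ X'.carrier) : Prop :=
  (∀ i f g, P'.pref i (inclAct h f) (inclAct h g) ↔ P.pref i f g) ∧
  ∀ (x' : X'.carrier) (i : Fin n), ∃ b w : X.carrier,
    P'.pref i (constAct Ω (Set.inclusion h b)) (constAct Ω x') ∧
    P'.pref i (constAct Ω x') (constAct Ω (Set.inclusion h w))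

end Profile

/-- Aggregation rules: a complete and transitive social preference over acts for every problem. -/
structure AggRule (n : ℕ) (Ω : Type*) [MeasurableSpace Ω] (O : Type*) where
  rel : ∀ {X : FeasibleSet O}, Profile n Ω X → Act Ω X → Act Ω X → Prop
  complete : ∀ {X : FeasibleSet O} (P : Profile n Ω X) (f g : Act Ω X), rel P f g ∨ rel P g f
  transitive : ∀ {X : FeasibleSet O} (P : Profile n Ω X) (f g h : Act Ω X),
    rel P f g → rel P g h → rel P f h

namespace AggRule

variable {n : ℕ} {Ω : Type*} [MeasurableSpace Ω] {O : Type*}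

def ParetoPrinciple (R : AggRule n Ω O) : Prop :=
  ∀ (X : FeasibleSet O) (P : Profile n Ω X) (f g : Act Ω X),
    ((∀ i, P.pref i f g) → R.rel P f g) ∧
    ((∀ i, P.pref i f g ∧ ¬ P.pref i g f) → R.rel P f g ∧ ¬ R.rel P g f)

def Continuity (R : AggRule n Ω O) : Prop :=
  ∀ (X : FeasibleSet O) (P : Profile n Ω X) (f g : Act Ω X) (F : ℕ → Act Ω X),
    Tendsto (fun t => fun i => P.normSEU i (F t)) atTop (𝓝 (fun i => P.normSEU i f)) →
    ((∀ t, R.rel P (F t) g) → R.rel P f g) ∧ ((∀ t, R.rel P g (F t)) → R.rel P g f)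

/-- Independence of inessential expansion. -/
def IIE (R : AggRule n Ω O) : Prop :=
  ∀ (X X' : FeasibleSet O) (P : Profile n Ω X) (P' : Profile n Ω X')
    (h : X.carrier ⊆ X'.carrier), P.IsInessentialExpansion P' h →
    ∀ f g : Act Ω X, R.rel P' (inclAct h f) (inclAct h g) ↔ R.rel P f g

def WeakPreferenceForMixing (R : AggRule n Ω O) : Prop :=
  ∀ (X : FeasibleSet O) (P : Profile n Ω X) (x y : X.carrier) (E : Set Ω) (hE : MeasurableSet E),
    P.IsCoinToss E →
    R.rel P (betAct x y E hE) (constAct Ω x) ∨ R.rel P (betAct x y E hE) (constAct Ω y)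

def BeliefIrrelevance (R : AggRule n Ω O) : Prop :=
  ∀ (X : FeasibleSet O) (P P' : Profile n Ω X), (∀ i x, P.normValue i x = P'.normValue i x) →
    ∀ x y : X.carrier,
      R.rel P (constAct Ω x) (constAct Ω y) ↔ R.rel P' (constAct Ω x) (constAct Ω y)

def RestrictedCertaintyIndependence (R : AggRule n Ω O) : Prop :=
  ∀ (X : FeasibleSet O) (P : Profile n Ω X), (∀ i j x, P.normValue i x = P.normValue j x) →
    ∀ (f g : Act Ω X) (x : X.carrier) (α : ℝ), 0 < α → α < 1 →
      ∀ f' g' : Act Ω X, P.IsPseudoMix f x α f' → P.IsPseudoMix g x α g' →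
        (R.rel P f g ↔ R.rel P f' g')

def Anonymity (R : AggRule n Ω O) : Prop :=
  ∀ (X : FeasibleSet O) (P : Profile n Ω X) (π : Equiv.Perm (Fin n)) (f g : Act Ω X),
    R.rel P f g ↔ R.rel (P.permute π) f g

end AggRule

/-- The least weighted sum of the coordinates of `u` over weights in `M`; the infimum is a minimum
when `M` is nonempty and compact. -/
noncomputable def minWeighted {n : ℕ} (M : Set (Fin n → ℝ)) (u : Fin n → ℝ) : ℝ :=
  sInf ((fun μ : Fin n → ℝ => ∑ i, μ i * u i) '' M)

/-- `R` is the relative fair aggregation rule associated with the weight set `M`; the same `M` serves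
for all problems. -/
structure IsRelativeFair {n : ℕ} {Ω : Type*} [MeasurableSpace Ω] {O : Type*}
    (R : AggRule n Ω O) (M : Set (Fin n → ℝ)) : Prop where
  subset_simplex : M ⊆ stdSimplex ℝ (Fin n)
  nonempty : M.Nonempty
  isClosed : IsClosed M
  convex : Convex ℝ M
  rel_iff : ∀ (X : FeasibleSet O) (P : Profile n Ω X) (f g : Act Ω X),
    R.rel P f g ↔
      minWeighted M (fun i => P.normSEU i g) ≤ minWeighted M (fun i => P.normSEU i f)

def SymmetricWeights {n : ℕ} (M : Set (Fin n → ℝ)) : Prop :=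
  ∀ μ ∈ M, ∀ π : Equiv.Perm (Fin n), (fun i => μ (π i)) ∈ M

end FairAgg

/-! The forward direction first reduces everything to utility vectors. Restrict a comparison of two
acts to a finite problem. Adjoin fresh outcomes whose normalized values are the utility vectors of
the acts. Pareto indifference then replaces the acts by these outcomes, and IIE carries the ranking
between the problems (`rel_iff_rel_const`). On the fresh outcomes belief irrelevance allows the
beliefs to be changed, so the ranking depends only on the two vectors of normalized expected
utilities (`rel_iff_of_normSEU_eq`). One relation `socialOrder` on `[0,1]^n` thus governs all
problems.

The axioms become properties of this relation by realizing given vectors inside suitable problems.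
The delicate case is certainty independence, where value functions must coincide. There the beliefs
are concentrated on disjoint events, one per individual; acts constant on these events then produce
every utility vector, and pseudo-mixtures exist (`socialOrder_certainty`).

The rest is a Gilboa–Schmeidler argument. The certainty equivalent represents the order and commutes
with mixing by constants. Shifting by constants turns preference for mixing into midpoint concavity,
so the homogeneous extension `certExt` is superadditive. Hahn–Banach supplies a linear functional
above it that touches it at a prescribed vector; monotonicity and the values at `1` and `-1` make
that functional a weight vector (`exists_mem_weights`). The certainty equivalent is therefore a
minimum over weights, and anonymity makes the set of weights symmetric.

Conversely, a minimum over weights in the simplex is monotone, 1-Lipschitz, concave and compatible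
with positive affine maps, which yields the axioms. Throughout, Sierpiński's theorem and uniqueness
of expected utility representations make the chosen values and beliefs computable. -/

namespace FairAgg

/-! ### Nonatomic probability measures -/

section Measure

variable {Ω : Type*} [MeasurableSpace Ω] {p q : Measure Ω}

/-- Nonatomicity splits an event into two pieces of positive measure, one of which has at most half
the measure; iterate. -/
theorem Nonatomic.exists_subset_measureReal_le [IsFiniteMeasure p] (h : Nonatomic p) {A : Set Ω}
    (hA : MeasurableSet A) (hpos : 0 < p.real A) {ε : ℝ} (hε : 0 < ε) :
    ∃ B ⊆ A, MeasurableSet B ∧ 0 < p.real B ∧ p.real B ≤ ε := by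
  have key : ∀ k : ℕ, ∃ B ⊆ A, MeasurableSet B ∧ 0 < p.real B ∧
      p.real B ≤ p.real A * (1 / 2) ^ k := by
    intro k
    induction k with
    | zero => exact ⟨A, subset_rfl, hA, hpos, by simp⟩
    | succ k ih =>
      obtain ⟨B, hBA, hB, hB0, hBk⟩ := ih
      obtain ⟨C, hCB, hC, hC0, hClt⟩ := h B hB (ENNReal.toReal_pos_iff.1 hB0).1
      have hC0' : 0 < p.real C := ENNReal.toReal_pos_iff.2 ⟨hC0, measure_lt_top _ _⟩
      have hlt : p.real C < p.real B :=
        (ENNReal.toReal_lt_toReal (measure_ne_top _ _) (measure_ne_top _ _)).2 hClt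
      have hdiff : p.real (B \ C) = p.real B - p.real C := measureReal_sdiff hCB hC
      rw [pow_succ]
      by_cases hh : p.real C ≤ p.real B / 2
      · exact ⟨C, hCB.trans hBA, hC, hC0', by linarith⟩
      · exact ⟨B \ C, Set.sdiff_subset.trans hBA, hB.diff hC, by linarith, by linarith⟩
  obtain ⟨k, hk⟩ := exists_pow_lt_of_lt_one (div_pos hε hpos) (by norm_num : (1 / 2 : ℝ) < 1)
  obtain ⟨B, hBA, hB, hB0, hBk⟩ := key k
  refine ⟨B, hBA, hB, hB0, hBk.trans ?_⟩
  rw [lt_div_iff₀ hpos] at hk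
  linarith

/-- One greedy step: an almost optimal enlargement of `B` within `A` of measure at most `t`. -/
theorem exists_greedy_enlargement [IsFiniteMeasure p] {A B : Set Ω} {t : ℝ}
    (hB : MeasurableSet B) (hBA : B ⊆ A) (hBt : p.real B ≤ t) :
    ∃ B', MeasurableSet B' ∧ B ⊆ B' ∧ B' ⊆ A ∧ p.real B' ≤ t ∧
      ∀ D ⊆ A \ B, MeasurableSet D → p.real B + p.real D ≤ t →
        p.real D ≤ 2 * (p.real B' - p.real B) := by
  set S : Set ℝ := {r | ∃ D ⊆ A \ B, MeasurableSet D ∧ p.real B + p.real D ≤ t ∧ p.real D = r}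
  have hbdd : BddAbove S := ⟨t - p.real B, by rintro r ⟨D, -, -, h, rfl⟩; linarith⟩
  have h0 : (0 : ℝ) ∈ S := ⟨∅, by simp, by simp, by simpa using hBt, by simp⟩
  by_cases hS : sSup S = 0
  · refine ⟨B, hB, subset_rfl, hBA, hBt, fun D hD hDm hDt => ?_⟩
    have := le_csSup hbdd (show p.real D ∈ S from ⟨D, hD, hDm, hDt, rfl⟩)
    linarith
  · have hpos : 0 < sSup S := lt_of_le_of_ne (le_csSup hbdd h0) (Ne.symm hS)
    obtain ⟨r, ⟨C, hC, hCm, hCt, rfl⟩, hr⟩ := exists_lt_of_lt_csSup ⟨0, h0⟩ (half_lt_self hpos)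
    have hdisj : Disjoint B C := Set.disjoint_left.2 fun x hx hx' => (hC hx').2 hx
    have hun : p.real (B ∪ C) = p.real B + p.real C := measureReal_union hdisj hCm
    refine ⟨B ∪ C, hB.union hCm, Set.subset_union_left,
      Set.union_subset hBA (hC.trans Set.sdiff_subset), by linarith, fun D hD hDm hDt => ?_⟩
    have := le_csSup hbdd (show p.real D ∈ S from ⟨D, hD, hDm, hDt, rfl⟩)
    linarith

/-- Sierpiński's theorem: a finite nonatomic measure takes all intermediate values. -/
theorem Nonatomic.exists_subset_measureReal_eq [IsFiniteMeasure p] (h : Nonatomic p) {A : Set Ω}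
    (hA : MeasurableSet A) {t : ℝ} (ht0 : 0 ≤ t) (htA : t ≤ p.real A) :
    ∃ B ⊆ A, MeasurableSet B ∧ p.real B = t := by
  let T := {B : Set Ω // MeasurableSet B ∧ B ⊆ A ∧ p.real B ≤ t}
  have hstep : ∀ B : T, ∃ B' : T, B.1 ⊆ B'.1 ∧ ∀ D ⊆ A \ B.1, MeasurableSet D →
      p.real B.1 + p.real D ≤ t → p.real D ≤ 2 * (p.real B'.1 - p.real B.1) := by
    rintro ⟨B, hB, hBA, hBt⟩
    obtain ⟨B', h1, h2, h3, h4, h5⟩ := exists_greedy_enlargement hB hBA hBt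
    exact ⟨⟨B', h1, h3, h4⟩, h2, h5⟩
  choose F hF1 hF2 using hstep
  let B : ℕ → T := fun k => F^[k] ⟨∅, by simp, by simp, by simpa using ht0⟩
  have hBs : ∀ k, B (k + 1) = F (B k) := fun k => Function.iterate_succ_apply' F k _
  have hmono : Monotone fun k => (B k).1 :=
    monotone_nat_of_le_succ fun k => by rw [hBs]; exact hF1 _
  have hlim : Tendsto (fun k => p.real (B k).1) atTop (𝓝 (p.real (⋃ k, (B k).1))) :=
    (ENNReal.tendsto_toReal (measure_ne_top _ _)).comp (tendsto_measure_iUnion_atTop hmono)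
  have hUm : MeasurableSet (⋃ k, (B k).1) := MeasurableSet.iUnion fun k => (B k).2.1
  have hUA : (⋃ k, (B k).1) ⊆ A := Set.iUnion_subset fun k => (B k).2.2.1
  have hUt : p.real (⋃ k, (B k).1) ≤ t := le_of_tendsto' hlim fun k => (B k).2.2.2
  refine ⟨_, hUA, hUm, hUt.eq_of_not_lt fun hlt => ?_⟩
  have hd : p.real (A \ ⋃ k, (B k).1) = p.real A - p.real (⋃ k, (B k).1) :=
    measureReal_sdiff hUA hUm
  obtain ⟨D, hDA, hD, hD0, hDt⟩ := h.exists_subset_measureReal_le (hA.diff hUm)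
    (by rw [hd]; linarith) (sub_pos.2 hlt)
  -- `D` could be added at every stage, so each greedy gain is at least half its measure; but the
  -- gains of a convergent sequence tend to zero.
  have hle : ∀ k, p.real D ≤ 2 * (p.real (B (k + 1)).1 - p.real (B k).1) := by
    intro k
    rw [hBs]
    refine hF2 _ D (hDA.trans (Set.sdiff_subset_sdiff_right (Set.subset_iUnion (fun k => (B k).1) k))) hD ?_
    have : p.real (B k).1 ≤ p.real (⋃ k, (B k).1) :=
      measureReal_mono (Set.subset_iUnion (fun k => (B k).1) k)
    linarith
  have hz := ((hlim.comp (tendsto_add_atTop_nat 1)).sub hlim).const_mul 2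
  have := ge_of_tendsto' hz hle
  simp at this
  linarith

/-- Two probability measures that order events in the same way give the same probability to events
of rational probability. -/
theorem measureReal_eq_of_ordinallyEquivalent_rat [IsProbabilityMeasure p] [IsProbabilityMeasure q]
    (h : Nonatomic p)
    (hpq : ∀ E F, MeasurableSet E → MeasurableSet F → (p.real E ≤ p.real F ↔ q.real E ≤ q.real F))
    {k m : ℕ} (hm : 0 < m) (hk : k ≤ m) :
    ∃ B, MeasurableSet B ∧ p.real B = k / m ∧ q.real B = k / m := by
  have hm' : (0 : ℝ) < m := by exact_mod_cast hm
  have heq : ∀ E F, MeasurableSet E → MeasurableSet F → p.real E = p.real F →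
      q.real E = q.real F := fun E F hE hF he =>
    le_antisymm ((hpq E F hE hF).1 he.le) ((hpq F E hF hE).1 he.ge)
  have h1m : (1 : ℝ) / m ≤ 1 := by
    rw [div_le_one hm']; exact_mod_cast hm
  obtain ⟨C, -, hC, hCp⟩ := h.exists_subset_measureReal_eq MeasurableSet.univ
    (by positivity : (0 : ℝ) ≤ 1 / m) (by simpa using h1m)
  have key : ∀ k : ℕ, k ≤ m → ∃ B, MeasurableSet B ∧ p.real B = k / m ∧
      q.real B = k * q.real C := by
    intro k
    induction k with
    | zero => exact fun _ => ⟨∅, by simp, by simp, by simp⟩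
    | succ k ih =>
      intro hk
      obtain ⟨B, hB, hBp, hBq⟩ := ih (by omega)
      have hk' : ((k : ℝ) + 1) / m ≤ 1 := by
        rw [div_le_one hm']; exact_mod_cast hk
      obtain ⟨D, hDB, hD, hDp⟩ := h.exists_subset_measureReal_eq hB.compl
        (by positivity : (0 : ℝ) ≤ 1 / m) (by
          rw [probReal_compl_eq_one_sub hB, hBp]; rw [add_div] at hk'; linarith)
      have hdisj : Disjoint B D := Set.disjoint_left.2 fun x hx hx' => hDB hx' hx
      refine ⟨B ∪ D, hB.union hD, ?_, ?_⟩
      · rw [measureReal_union hdisj hD, hBp, hDp]; push_cast; ring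
      · rw [measureReal_union hdisj hD, hBq, heq D C hD hC (hDp.trans hCp.symm)]; push_cast; ring
  -- All pieces of `p`-measure `1 / m` have the `q`-measure of `C`; the case `k = m` fixes it, since
  -- `m` pieces exhaust the space.
  obtain ⟨B, hB, hBp, hBq⟩ := key m le_rfl
  have hone : q.real B = 1 := by
    rw [heq B Set.univ hB MeasurableSet.univ (by rw [hBp, div_self hm'.ne']; simp)]; simp
  have hCq : q.real C = 1 / m := by
    rw [hone] at hBq; rw [eq_div_iff hm'.ne']; linarith
  obtain ⟨B, hB, hBp, hBq⟩ := key k hk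
  exact ⟨B, hB, hBp, by rw [hBq, hCq]; ring⟩

/-- If the measures differed at an event, an event of rational probability strictly in between, on
which they agree, would be ordered differently by the two. -/
theorem eq_of_ordinallyEquivalent [IsProbabilityMeasure p] [IsProbabilityMeasure q]
    (h : Nonatomic p)
    (hpq : ∀ E F, MeasurableSet E → MeasurableSet F →
      (p.real E ≤ p.real F ↔ q.real E ≤ q.real F)) : p = q := by
  have hrat : ∀ r : ℚ, 0 ≤ r → r ≤ 1 → ∃ B, MeasurableSet B ∧ p.real B = r ∧ q.real B = r := by
    intro r h0 h1
    have hr : (r : ℝ) = (r.num.toNat : ℝ) / r.den := by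
      have hn : ((r.num.toNat : ℤ) : ℝ) = r.num := by rw [Int.toNat_of_nonneg (Rat.num_nonneg.2 h0)]
      rw [Int.cast_natCast] at hn
      rw [hn, ← Rat.cast_def]
    have hle : r.num.toNat ≤ r.den := by
      have : (r.num.toNat : ℝ) / r.den ≤ 1 := by rw [← hr]; exact_mod_cast h1
      rw [div_le_one (by exact_mod_cast r.den_pos)] at this
      exact_mod_cast this
    rw [hr]
    exact measureReal_eq_of_ordinallyEquivalent_rat h hpq r.den_pos hle
  refine Measure.ext fun E hE => ?_
  rw [← ENNReal.toReal_eq_toReal_iff' (measure_ne_top _ _) (measure_ne_top _ _)]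
  change p.real E = q.real E
  have hp1 : p.real E ≤ 1 := measureReal_le_one
  have hq1 : q.real E ≤ 1 := measureReal_le_one
  have hp0 : 0 ≤ p.real E := measureReal_nonneg
  have hq0 : 0 ≤ q.real E := measureReal_nonneg
  rcases lt_trichotomy (p.real E) (q.real E) with hlt | heq | hlt
  · obtain ⟨r, hr1, hr2⟩ := exists_rat_btwn hlt
    obtain ⟨B, hB, hBp, hBq⟩ := hrat r (by exact_mod_cast (hp0.trans hr1.le))
      (by exact_mod_cast (hr2.le.trans hq1))
    have := (hpq E B hE hB).1 (by linarith)
    linarith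
  · exact heq
  · obtain ⟨r, hr1, hr2⟩ := exists_rat_btwn hlt
    obtain ⟨B, hB, hBp, hBq⟩ := hrat r (by exact_mod_cast (hq0.trans hr1.le))
      (by exact_mod_cast (hr2.le.trans hp1))
    have := (hpq E B hE hB).2 (by linarith)
    linarith

/-- Conditioning on the cells of a partition supplies admissible beliefs concentrated on disjoint
events. -/
theorem Nonatomic.cond (h : Nonatomic p) [IsFiniteMeasure p] {E : Set Ω} (hE : MeasurableSet E) :
    Nonatomic (ProbabilityTheory.cond p E) := by
  intro A hA hpos
  have hc : ∀ s, ProbabilityTheory.cond p E s = (p E)⁻¹ * p (E ∩ s) :=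
    fun s => ProbabilityTheory.cond_apply hE p s
  rw [hc] at hpos
  have hpos' := (ENNReal.mul_pos_iff.1 hpos)
  obtain ⟨B, hBA, hB, hB0, hBlt⟩ := h (E ∩ A) (hE.inter hA) hpos'.2
  have hEB : E ∩ B = B := Set.inter_eq_right.2 (hBA.trans Set.inter_subset_left)
  have hE0 : p E ≠ 0 := fun h0 =>
    hpos'.2.ne' (measure_mono_null Set.inter_subset_left h0)
  refine ⟨B, hBA.trans Set.inter_subset_right, hB, ?_, ?_⟩
  · rw [hc, hEB]; exact ENNReal.mul_pos hpos'.1.ne' hB0.ne'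
  · rw [hc, hc, hEB]
    exact ENNReal.mul_lt_mul_right hpos'.1.ne' (ENNReal.inv_ne_top.2 hE0) hBlt

/-- A nonatomic probability measure admits finite measurable partitions of any size into events of
positive measure. -/
theorem Nonatomic.exists_partition [IsProbabilityMeasure p] (h : Nonatomic p) (k : ℕ) :
    ∃ κ : SimpleFunc Ω (Fin (k + 1)), ∀ i, 0 < p (κ ⁻¹' {i}) := by
  classical
  induction k with
  | zero =>
    refine ⟨SimpleFunc.const Ω 0, fun i => ?_⟩
    have : (SimpleFunc.const Ω (0 : Fin (0 + 1))) ⁻¹' {i} = Set.univ :=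
      Set.eq_univ_of_forall fun ω => (Fin.fin_one_eq_zero i).symm
    rw [this]
    simp
  | succ k ih =>
    obtain ⟨κ, hκ⟩ := ih
    obtain ⟨B, hBA, hB, hB0, hBlt⟩ := h _ (κ.measurableSet_fiber 0) (hκ 0)
    refine ⟨SimpleFunc.piecewise B hB (SimpleFunc.const Ω (Fin.last _)) (κ.map Fin.castSucc),
      fun i => ?_⟩
    induction i using Fin.lastCases with
    | last =>
      refine hB0.trans_le (measure_mono fun ω hω => ?_)
      simp [hω]
    | cast i =>
      by_cases hi : i = 0
      · subst hi
        have : 0 < p (κ ⁻¹' {0} \ B) := by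
          rw [measure_sdiff hBA hB.nullMeasurableSet (measure_ne_top _ _)]
          exact tsub_pos_of_lt hBlt
        refine this.trans_le (measure_mono fun ω hω => ?_)
        have h1 : κ ω = 0 := hω.1
        have h2 : ω ∉ B := hω.2
        simp [h1, h2]
      · refine (hκ i).trans_le (measure_mono fun ω hω => ?_)
        have h1 : κ ω = i := hω
        have h2 : ω ∉ B := fun hb => hi (h1.symm.trans (hBA hb))
        simp [h1, h2]

end Measure

end FairAgg

/-! ### Uniqueness of expected utility representations and normalized profiles -/

namespace FairAgg

section SEU

variable {Ω : Type*} [MeasurableSpace Ω] {O : Type*} {X X' : FeasibleSet O}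

theorem integrable_comp_act {p : Measure Ω} [IsFiniteMeasure p] (u : X.carrier → ℝ) (f : Act Ω X) :
    Integrable (fun ω => u (f ω)) p :=
  (f.map u).integrable_of_isFiniteMeasure

theorem integral_comp_act_eq_sum {p : Measure Ω} [IsFiniteMeasure p] (u : X.carrier → ℝ)
    (f : Act Ω X) (S : Finset X.carrier) (hS : f.range ⊆ S) :
    ∫ ω, u (f ω) ∂p = ∑ y ∈ S, p.real (f ⁻¹' {y}) * u y := by
  classical
  have h : ∀ ω, u (f ω) = ∑ y ∈ S, (f ⁻¹' {y}).indicator (fun _ => u y) ω := by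
    intro ω
    rw [Finset.sum_eq_single (f ω)]
    · simp
    · intro y _ hy
      exact Set.indicator_of_notMem (fun hω => hy (Eq.symm hω)) _
    · exact fun hn => absurd (hS (f.mem_range_self ω)) hn
  simp_rw [h]
  rw [integral_finsetSum]
  · refine Finset.sum_congr rfl fun y _ => ?_
    rw [integral_indicator_const _ (f.measurableSet_fiber y), smul_eq_mul]
  · exact fun y _ => (integrable_const _).indicator (f.measurableSet_fiber y)

theorem integral_comp_betAct {p : Measure Ω} [IsProbabilityMeasure p] (u : X.carrier → ℝ)
    (x y : X.carrier) {E : Set Ω} (hE : MeasurableSet E) :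
    ∫ ω, u (betAct x y E hE ω) ∂p = p.real E * u x + (1 - p.real E) * u y := by
  classical
  have h : ∀ ω, u (betAct x y E hE ω) = E.indicator (fun _ => u x - u y) ω + u y := by
    intro ω
    by_cases hω : ω ∈ E <;> simp [betAct, hω]
  simp_rw [h]
  rw [integral_add ((integrable_const _).indicator hE) (integrable_const _),
    integral_indicator_const _ hE]
  simp only [smul_eq_mul, integral_const, probReal_univ]
  ring

namespace IsSEURep

variable {R : Act Ω X → Act Ω X → Prop} {u v : X.carrier → ℝ} {p q : Measure Ω}

theorem const_iff (h : IsSEURep R u p) (x y : X.carrier) :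
    R (constAct Ω x) (constAct Ω y) ↔ u y ≤ u x := by
  have := h.isProbabilityMeasure
  rw [h.represents]
  simp

/-- Bets on a strictly ranked pair of outcomes reveal the likelihood order of events, which
determines a nonatomic belief. -/
theorem belief_unique (h : IsSEURep R u p) (h' : IsSEURep R v q) : p = q := by
  have := h.isProbabilityMeasure
  have := h'.isProbabilityMeasure
  obtain ⟨x, y, hxy⟩ : ∃ x y, u y < u x := by
    obtain ⟨x, y, hxy⟩ := h.nonconstant
    rcases lt_or_gt_of_ne hxy with hlt | hlt
    exacts [⟨y, x, hlt⟩, ⟨x, y, hlt⟩]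
  have hv : v y < v x := by
    rw [← not_le] at hxy ⊢
    rwa [← h'.const_iff, h.const_iff]
  refine eq_of_ordinallyEquivalent h.nonatomic fun E F hE hF => ?_
  have h1 := h.represents (betAct x y F hF) (betAct x y E hE)
  have h2 := h'.represents (betAct x y F hF) (betAct x y E hE)
  rw [integral_comp_betAct, integral_comp_betAct] at h1 h2
  have e1 : p.real E ≤ p.real F ↔ p.real E * u x + (1 - p.real E) * u y ≤
      p.real F * u x + (1 - p.real F) * u y := by
    constructor <;> intro hh <;> nlinarith
  have e2 : q.real E ≤ q.real F ↔ q.real E * v x + (1 - q.real E) * v y ≤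
      q.real F * v x + (1 - q.real F) * v y := by
    constructor <;> intro hh <;> nlinarith
  rw [e1, e2, ← h1, ← h2]

/-- By Sierpiński's theorem `x` is indifferent to a bet between `b` and `w` with the right winning
probability; the other representation must respect this indifference. -/
theorem value_unique (h : IsSEURep R u p) (h' : IsSEURep R v q) {b w x : X.carrier}
    (hwx : u w ≤ u x) (hxb : u x ≤ u b) (hwb : u w < u b) :
    v x - v w = (u x - u w) / (u b - u w) * (v b - v w) := by
  obtain rfl := h.belief_unique h'
  have := h.isProbabilityMeasure
  have hpos : 0 < u b - u w := sub_pos.2 hwb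
  obtain ⟨E, -, hE, hEp⟩ := h.nonatomic.exists_subset_measureReal_eq MeasurableSet.univ
    (div_nonneg (sub_nonneg.2 hwx) hpos.le)
    (by simpa using (div_le_one hpos).2 (by linarith) : (u x - u w) / (u b - u w) ≤ p.real Set.univ)
  have e1 : ∫ ω, u (betAct b w E hE ω) ∂p = ∫ ω, u (constAct Ω x ω) ∂p := by
    rw [integral_comp_betAct, hEp]
    simp only [constAct, SimpleFunc.const_apply, integral_const, probReal_univ, smul_eq_mul]
    field_simp
    ring
  have h1 := (h'.represents _ _).1 ((h.represents _ _).2 e1.le)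
  have h2 := (h'.represents _ _).1 ((h.represents _ _).2 e1.ge)
  have e2 := le_antisymm h1 h2
  rw [integral_comp_betAct, hEp] at e2
  simp only [constAct, SimpleFunc.const_apply, integral_const, probReal_univ, smul_eq_mul] at e2
  linarith

end IsSEURep

/-- Value functions with maximum `1` and minimum `0`. -/
structure IsNormalized (u : X.carrier → ℝ) : Prop where
  nonneg : ∀ x, 0 ≤ u x
  le_one : ∀ x, u x ≤ 1
  exists_eq_one : ∃ x, u x = 1
  exists_eq_zero : ∃ x, u x = 0

theorem IsNormalized.isSEURep {u : X.carrier → ℝ} (hu : IsNormalized u) {p : Measure Ω}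
    (hp : IsProbabilityMeasure p) (hna : Nonatomic p) :
    IsSEURep (fun f g : Act Ω X => ∫ ω, u (g ω) ∂p ≤ ∫ ω, u (f ω) ∂p) u p where
  nonconstant := by
    obtain ⟨x, hx⟩ := hu.exists_eq_one
    obtain ⟨y, hy⟩ := hu.exists_eq_zero
    exact ⟨x, y, by rw [hx, hy]; exact one_ne_zero⟩
  bounded := ⟨1, fun x => abs_le.2 ⟨by linarith [hu.nonneg x], hu.le_one x⟩⟩
  isProbabilityMeasure := hp
  nonatomic := hna
  represents _ _ := Iff.rfl

namespace Profile

variable {n : ℕ}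

theorem isSEURep (P : Profile n Ω X) (i : Fin n) :
    IsSEURep (P.pref i) (P.value i) (P.belief i) :=
  (P.isSEU i).choose_spec.choose_spec

instance (P : Profile n Ω X) (i : Fin n) : IsProbabilityMeasure (P.belief i) :=
  (P.isSEURep i).isProbabilityMeasure

theorem nonatomic_belief (P : Profile n Ω X) (i : Fin n) : Nonatomic (P.belief i) :=
  (P.isSEURep i).nonatomic

theorem exists_value_extremes (P : Profile n Ω X) (i : Fin n) :
    ∃ b w, P.value i w < P.value i b ∧ (∀ x, P.value i x ≤ P.value i b) ∧
      (∀ x, P.value i w ≤ P.value i x) ∧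
      ∀ x, P.normValue i x = (P.value i x - P.value i w) / (P.value i b - P.value i w) := by
  obtain ⟨b, hb⟩ := P.best i
  obtain ⟨w, hw⟩ := P.worst i
  simp only [(P.isSEURep i).const_iff] at hb hw
  have : Nonempty X.carrier := ⟨b⟩
  have hsup : ⨆ y, P.value i y = P.value i b :=
    IsLUB.ciSup_eq (f := P.value i)
      ⟨by rintro _ ⟨x, rfl⟩; exact hb x, fun c hc => hc (Set.mem_range_self b)⟩
  have hinf : ⨅ y, P.value i y = P.value i w :=
    IsGLB.ciInf_eq (f := P.value i)
      ⟨by rintro _ ⟨x, rfl⟩; exact hw x, fun c hc => hc (Set.mem_range_self w)⟩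
  refine ⟨b, w, ?_, hb, hw, fun x => by rw [normValue, hsup, hinf]⟩
  refine (hw b).lt_of_ne fun he => ?_
  obtain ⟨x, y, hxy⟩ := (P.isSEURep i).nonconstant
  exact hxy (le_antisymm ((hb x).trans (he.symm.le.trans (hw y)))
    ((hb y).trans (he.symm.le.trans (hw x))))

theorem isNormalized_normValue (P : Profile n Ω X) (i : Fin n) : IsNormalized (P.normValue i) := by
  obtain ⟨b, w, hlt, hb, hw, hn⟩ := P.exists_value_extremes i
  have hpos := sub_pos.2 hlt
  refine ⟨fun x => ?_, fun x => ?_, ⟨b, ?_⟩, ⟨w, ?_⟩⟩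
  · rw [hn]; exact div_nonneg (sub_nonneg.2 (hw x)) hpos.le
  · rw [hn, div_le_one hpos]; linarith [hb x]
  · rw [hn, div_self hpos.ne']
  · rw [hn, sub_self, zero_div]

theorem pref_iff (P : Profile n Ω X) (i : Fin n) (f g : Act Ω X) :
    P.pref i f g ↔ P.normSEU i g ≤ P.normSEU i f := by
  obtain ⟨b, w, hlt, hb, hw, hn⟩ := P.exists_value_extremes i
  have hpos := sub_pos.2 hlt
  have h : ∀ f : Act Ω X, P.normSEU i f =
      ((∫ ω, P.value i (f ω) ∂(P.belief i)) - P.value i w) / (P.value i b - P.value i w) := by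
    intro f
    simp only [normSEU, hn]
    rw [integral_div, integral_sub (integrable_comp_act _ _) (integrable_const _)]
    simp
  rw [(P.isSEURep i).represents, h, h, div_le_div_iff_of_pos_right hpos, sub_le_sub_iff_right]

theorem isSEURep_normValue (P : Profile n Ω X) (i : Fin n) :
    IsSEURep (P.pref i) (P.normValue i) (P.belief i) := by
  have h := (P.isNormalized_normValue i).isSEURep (P.isSEURep i).isProbabilityMeasure
    (P.nonatomic_belief i)
  convert h using 3
  exact P.pref_iff i _ _

theorem belief_eq (P : Profile n Ω X) {i : Fin n} {u : X.carrier → ℝ} {p : Measure Ω}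
    (h : IsSEURep (P.pref i) u p) : P.belief i = p :=
  (P.isSEURep i).belief_unique h

/-- Values and beliefs of a profile are obtained by choice; this lemma and `belief_eq` identify them
from any explicit representation. -/
theorem normValue_eq (P : Profile n Ω X) {i : Fin n} {u : X.carrier → ℝ} {p : Measure Ω}
    (h : IsSEURep (P.pref i) u p) (hu : IsNormalized u) : P.normValue i = u := by
  obtain ⟨b, hb⟩ := hu.exists_eq_one
  obtain ⟨w, hw⟩ := hu.exists_eq_zero
  obtain ⟨b', hb'⟩ := (P.isNormalized_normValue i).exists_eq_one
  obtain ⟨w', hw'⟩ := (P.isNormalized_normValue i).exists_eq_zero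
  have key : ∀ x, P.normValue i x - P.normValue i w = u x * (P.normValue i b - P.normValue i w) := by
    intro x
    have := h.value_unique (P.isSEURep_normValue i) (b := b) (w := w) (x := x)
      (by rw [hw]; exact hu.nonneg x) (by rw [hb]; exact hu.le_one x) (by rw [hb, hw]; exact one_pos)
    rwa [hb, hw, sub_zero, sub_zero, div_one] at this
  have k1 := key b'
  have k2 := key w'
  rw [hb'] at k1
  rw [hw'] at k2
  have hb1 := (P.isNormalized_normValue i).le_one b
  have hw0 := (P.isNormalized_normValue i).nonneg w
  have u1 := hu.le_one b'
  have u0 := hu.nonneg b'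
  have u0' := hu.nonneg w'
  have hpos : 0 ≤ P.normValue i b - P.normValue i w := by
    rw [sub_nonneg, ← (P.isSEURep_normValue i).const_iff, h.const_iff, hb, hw]
    exact zero_le_one
  -- Evaluating `key` at the chosen worst outcome `w'` gives `P.normValue i w ≤ 0`; evaluating it at
  -- `b'` then gives `1 ≤ P.normValue i b`.
  have hw00 : P.normValue i w = 0 := by nlinarith [mul_nonneg u0' hpos]
  have hb11 : P.normValue i b = 1 := by nlinarith
  funext x
  have := key x
  rw [hw00, hb11] at this
  linarith

/-- The profile with given normalized value functions and beliefs. -/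
def ofNormalized (w : Fin n → X.carrier → ℝ) (p : Fin n → Measure Ω)
    (hw : ∀ i, IsNormalized (w i)) (hp : ∀ i, IsProbabilityMeasure (p i))
    (hna : ∀ i, Nonatomic (p i)) : Profile n Ω X where
  pref i f g := ∫ ω, w i (g ω) ∂(p i) ≤ ∫ ω, w i (f ω) ∂(p i)
  isSEU i := ⟨w i, p i, (hw i).isSEURep (hp i) (hna i)⟩
  best i := by
    obtain ⟨b, hb⟩ := (hw i).exists_eq_one
    have := hp i
    exact ⟨b, fun x => by simpa [hb] using (hw i).le_one x⟩
  worst i := by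
    obtain ⟨b, hb⟩ := (hw i).exists_eq_zero
    have := hp i
    exact ⟨b, fun x => by simpa [hb] using (hw i).nonneg x⟩

section ofNormalized

variable {w : Fin n → X.carrier → ℝ} {p : Fin n → Measure Ω}
  {hw : ∀ i, IsNormalized (w i)} {hp : ∀ i, IsProbabilityMeasure (p i)}
  {hna : ∀ i, Nonatomic (p i)}

theorem normValue_ofNormalized (i : Fin n) : (ofNormalized w p hw hp hna).normValue i = w i :=
  normValue_eq _ ((hw i).isSEURep (hp i) (hna i)) (hw i)

theorem belief_ofNormalized (i : Fin n) : (ofNormalized w p hw hp hna).belief i = p i :=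
  belief_eq _ ((hw i).isSEURep (hp i) (hna i))

end ofNormalized

theorem normSEU_constAct (P : Profile n Ω X) (i : Fin n) (x : X.carrier) :
    P.normSEU i (constAct Ω x) = P.normValue i x := by
  simp [normSEU]

theorem normSEU_betAct (P : Profile n Ω X) (i : Fin n) (x y : X.carrier) {E : Set Ω}
    (hE : MeasurableSet E) : P.normSEU i (betAct x y E hE) =
      (P.belief i).real E * P.normValue i x + (1 - (P.belief i).real E) * P.normValue i y :=
  integral_comp_betAct _ _ _ _

theorem normSEU_mem_Icc (P : Profile n Ω X) (f : Act Ω X) :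
    (fun i => P.normSEU i f) ∈ Set.Icc (0 : Fin n → ℝ) 1 := by
  refine ⟨fun i => integral_nonneg fun ω => (P.isNormalized_normValue i).nonneg _, fun i => ?_⟩
  have := integral_mono (μ := P.belief i) (integrable_comp_act (P.normValue i) f)
    (integrable_const 1) fun ω => (P.isNormalized_normValue i).le_one (f ω)
  simpa [normSEU] using this

/-- Expected utility is linear in the distribution of outcomes, and a pseudo-mixture prescribes that
distribution for each individual. -/
theorem IsPseudoMix.normSEU_eq {P : Profile n Ω X} {f g : Act Ω X} {x : X.carrier} {α : ℝ}
    (h : P.IsPseudoMix f x α g) (i : Fin n) :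
    P.normSEU i g = α * P.normSEU i f + (1 - α) * P.normValue i x := by
  classical
  have hx : x ∈ f.range ∪ g.range ∪ {x} := by simp
  rw [normSEU, normSEU, integral_comp_act_eq_sum _ f (f.range ∪ g.range ∪ {x})
    (Finset.subset_union_left.trans Finset.subset_union_left),
    integral_comp_act_eq_sum _ g (f.range ∪ g.range ∪ {x})
    (Finset.subset_union_right.trans Finset.subset_union_left), Finset.mul_sum]
  have : (1 - α) * P.normValue i x =
      ∑ y ∈ f.range ∪ g.range ∪ {x}, if y = x then (1 - α) * P.normValue i y else 0 := by
    rw [Finset.sum_ite_eq' _ x, if_pos hx]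
  rw [this, ← Finset.sum_add_distrib]
  refine Finset.sum_congr rfl fun y _ => ?_
  rw [h i y]
  split_ifs <;> ring

/-- The smaller set already contains everyone's extremes, so the normalization is unaffected by
restriction and uniqueness of the representation applies. -/
theorem isInessentialExpansion_iff (P : Profile n Ω X) (P' : Profile n Ω X')
    (h : X.carrier ⊆ X'.carrier) : P.IsInessentialExpansion P' h ↔
      (∀ i, P'.belief i = P.belief i) ∧
        ∀ i x, P'.normValue i (Set.inclusion h x) = P.normValue i x := by
  constructor
  · rintro ⟨h1, h2⟩
    have hn : ∀ i, IsNormalized fun x => P'.normValue i (Set.inclusion h x) := by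
      intro i
      have hN := P'.isNormalized_normValue i
      refine ⟨fun x => hN.nonneg _, fun x => hN.le_one _, ?_, ?_⟩
      · obtain ⟨x', hx'⟩ := hN.exists_eq_one
        obtain ⟨b, -, hb, -⟩ := h2 x' i
        rw [(P'.isSEURep_normValue i).const_iff, hx'] at hb
        exact ⟨b, le_antisymm (hN.le_one _) hb⟩
      · obtain ⟨x', hx'⟩ := hN.exists_eq_zero
        obtain ⟨-, w, -, hw⟩ := h2 x' i
        rw [(P'.isSEURep_normValue i).const_iff, hx'] at hw
        exact ⟨w, le_antisymm hw (hN.nonneg _)⟩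
    have hrep : ∀ i, IsSEURep (P.pref i) (fun x => P'.normValue i (Set.inclusion h x))
        (P'.belief i) := by
      intro i
      have := (hn i).isSEURep (P'.isSEURep i).isProbabilityMeasure (P'.nonatomic_belief i)
      convert this using 3 with f g
      rw [← h1]
      exact P'.pref_iff i _ _
    exact ⟨fun i => (P.belief_eq (hrep i)).symm,
      fun i x => (congrFun (P.normValue_eq (hrep i) (hn i)) x).symm⟩
  · rintro ⟨h1, h2⟩
    have hS : ∀ i f, P'.normSEU i (inclAct h f) = P.normSEU i f := by
      intro i f
      simp only [normSEU, h1, inclAct, SimpleFunc.map_apply, h2]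
    refine ⟨fun i f g => by rw [pref_iff, pref_iff, hS, hS], fun x' i => ?_⟩
    obtain ⟨b, hb⟩ := (P.isNormalized_normValue i).exists_eq_one
    obtain ⟨w, hw⟩ := (P.isNormalized_normValue i).exists_eq_zero
    refine ⟨b, w, ?_, ?_⟩
    · rw [(P'.isSEURep_normValue i).const_iff, h2, hb]
      exact (P'.isNormalized_normValue i).le_one _
    · rw [(P'.isSEURep_normValue i).const_iff, h2, hw]
      exact (P'.isNormalized_normValue i).nonneg _

theorem IsInessentialExpansion.normSEU_inclAct {P : Profile n Ω X} {P' : Profile n Ω X'}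
    {h : X.carrier ⊆ X'.carrier} (hP : P.IsInessentialExpansion P' h) (i : Fin n) (f : Act Ω X) :
    P'.normSEU i (inclAct h f) = P.normSEU i f := by
  obtain ⟨h1, h2⟩ := (isInessentialExpansion_iff P P' h).1 hP
  simp only [normSEU, h1, inclAct, SimpleFunc.map_apply, h2]

end Profile

end SEU

end FairAgg

/-! ### Minima of weighted sums -/

namespace FairAgg

section MinWeighted

variable {n : ℕ} {M : Set (Fin n → ℝ)}

theorem isCompact_of_subset_stdSimplex (hM : M ⊆ stdSimplex ℝ (Fin n)) (hc : IsClosed M) :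
    IsCompact M :=
  (isCompact_stdSimplex ℝ (Fin n)).of_isClosed_subset hc hM

theorem exists_minWeighted_eq (hM : M ⊆ stdSimplex ℝ (Fin n)) (hc : IsClosed M) (hne : M.Nonempty)
    (u : Fin n → ℝ) :
    ∃ μ ∈ M, minWeighted M u = ∑ i, μ i * u i ∧ ∀ ν ∈ M, minWeighted M u ≤ ∑ i, ν i * u i := by
  obtain ⟨μ, hμ, hmin⟩ := (isCompact_of_subset_stdSimplex hM hc).exists_isMinOn hne
    (f := fun μ : Fin n → ℝ => ∑ i, μ i * u i) (by fun_prop)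
  have hl : IsLeast ((fun μ : Fin n → ℝ => ∑ i, μ i * u i) '' M) (∑ i, μ i * u i) :=
    ⟨⟨μ, hμ, rfl⟩, by rintro _ ⟨ν, hν, rfl⟩; exact hmin hν⟩
  have he : minWeighted M u = ∑ i, μ i * u i := hl.csInf_eq
  exact ⟨μ, hμ, he, fun ν hν => he.trans_le (hmin hν)⟩

theorem minWeighted_mono (hM : M ⊆ stdSimplex ℝ (Fin n)) (hc : IsClosed M) (hne : M.Nonempty)
    {u v : Fin n → ℝ} (h : u ≤ v) : minWeighted M u ≤ minWeighted M v := by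
  obtain ⟨μ, hμ, he, -⟩ := exists_minWeighted_eq hM hc hne v
  obtain ⟨-, -, -, hle⟩ := exists_minWeighted_eq hM hc hne u
  rw [he]
  exact (hle μ hμ).trans (Finset.sum_le_sum fun i _ => mul_le_mul_of_nonneg_left (h i) ((hM hμ).1 i))

theorem minWeighted_lt (hM : M ⊆ stdSimplex ℝ (Fin n)) (hc : IsClosed M) (hne : M.Nonempty)
    {u v : Fin n → ℝ} (h : ∀ i, u i < v i) : minWeighted M u < minWeighted M v := by
  obtain ⟨μ, hμ, he, -⟩ := exists_minWeighted_eq hM hc hne v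
  obtain ⟨-, -, -, hle⟩ := exists_minWeighted_eq hM hc hne u
  rw [he]
  refine (hle μ hμ).trans_lt (Finset.sum_lt_sum
    (fun i _ => mul_le_mul_of_nonneg_left (h i).le ((hM hμ).1 i)) ?_)
  obtain ⟨i, -, hi⟩ : ∃ i ∈ Finset.univ, 0 < μ i := by
    by_contra! hcon
    have := Finset.sum_nonpos hcon
    rw [(hM hμ).2] at this
    linarith
  exact ⟨i, Finset.mem_univ _, mul_lt_mul_of_pos_left (h i) hi⟩

/-- The weights are nonnegative and sum to one, so the minimum is 1-Lipschitz for the sup norm. -/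
theorem continuous_minWeighted (hM : M ⊆ stdSimplex ℝ (Fin n)) (hc : IsClosed M)
    (hne : M.Nonempty) : Continuous (minWeighted M) := by
  refine (LipschitzWith.of_le_add fun u v => ?_).continuous
  obtain ⟨μ, hμ, he, -⟩ := exists_minWeighted_eq hM hc hne v
  obtain ⟨-, -, -, hle⟩ := exists_minWeighted_eq hM hc hne u
  calc minWeighted M u ≤ ∑ i, μ i * u i := hle μ hμ
    _ ≤ ∑ i, (μ i * v i + μ i * dist u v) := by
        refine Finset.sum_le_sum fun i _ => ?_
        rw [← mul_add]
        refine mul_le_mul_of_nonneg_left ?_ ((hM hμ).1 i)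
        have := (le_abs_self (u i - v i)).trans (dist_le_pi_dist u v i)
        linarith
    _ = minWeighted M v + dist u v := by
        rw [Finset.sum_add_distrib, ← Finset.sum_mul, (hM hμ).2, one_mul, he]

theorem minWeighted_affine (hM : M ⊆ stdSimplex ℝ (Fin n)) (hc : IsClosed M)
    (hne : M.Nonempty) (u : Fin n → ℝ) {α : ℝ} (hα : 0 ≤ α) (c : ℝ) :
    minWeighted M (fun i => α * u i + c) = α * minWeighted M u + c := by
  have key : ∀ μ ∈ M, ∑ i, μ i * (α * u i + c) = α * ∑ i, μ i * u i + c := by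
    intro μ hμ
    have : ∑ i, μ i * (α * u i + c) = ∑ i, (α * (μ i * u i) + μ i * c) :=
      Finset.sum_congr rfl fun i _ => by ring
    rw [this, Finset.sum_add_distrib, ← Finset.sum_mul, (hM hμ).2, ← Finset.mul_sum, one_mul]
  obtain ⟨μ, hμ, he, hle⟩ := exists_minWeighted_eq hM hc hne u
  obtain ⟨ν, hν, he', hle'⟩ := exists_minWeighted_eq hM hc hne fun i => α * u i + c
  refine le_antisymm ?_ ?_
  · rw [he, ← key μ hμ]; exact hle' μ hμ
  · rw [he', key ν hν]
    gcongr
    exact hle ν hν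

/-- The weights that are minimal at the midpoint give it the average of their values at `u` and `v`,
and these are no less than the two minima. -/
theorem min_minWeighted_le (hM : M ⊆ stdSimplex ℝ (Fin n)) (hc : IsClosed M) (hne : M.Nonempty)
    (u v : Fin n → ℝ) :
    minWeighted M u ≤ minWeighted M (fun i => 1 / 2 * u i + (1 - 1 / 2) * v i) ∨
    minWeighted M v ≤ minWeighted M (fun i => 1 / 2 * u i + (1 - 1 / 2) * v i) := by
  obtain ⟨μ, hμ, he, -⟩ := exists_minWeighted_eq hM hc hne
    fun i => 1 / 2 * u i + (1 - 1 / 2) * v i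
  obtain ⟨-, -, -, hu⟩ := exists_minWeighted_eq hM hc hne u
  obtain ⟨-, -, -, hv⟩ := exists_minWeighted_eq hM hc hne v
  have e : ∑ i, μ i * (1 / 2 * u i + (1 - 1 / 2) * v i) =
      1 / 2 * ∑ i, μ i * u i + 1 / 2 * ∑ i, μ i * v i := by
    rw [Finset.mul_sum, Finset.mul_sum, ← Finset.sum_add_distrib]
    exact Finset.sum_congr rfl fun i _ => by ring
  rw [he, e]
  by_contra! hcon
  have := hu μ hμ
  have := hv μ hμ
  linarith [hcon.1, hcon.2]

theorem minWeighted_comp_perm (hs : SymmetricWeights M) (u : Fin n → ℝ)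
    (π : Equiv.Perm (Fin n)) : minWeighted M (fun i => u (π i)) = minWeighted M u := by
  have key : ∀ (v : Fin n → ℝ) (σ : Equiv.Perm (Fin n)),
      (fun μ : Fin n → ℝ => ∑ i, μ i * v (σ i)) '' M ⊆
        (fun μ : Fin n → ℝ => ∑ i, μ i * v i) '' M := by
    rintro v σ _ ⟨μ, hμ, rfl⟩
    refine ⟨_, hs μ hμ σ⁻¹, ?_⟩
    exact Fintype.sum_equiv σ⁻¹ _ _ fun i => by simp
  refine congrArg sInf (Set.Subset.antisymm (key u π) ?_)
  have := key (fun i => u (π i)) π⁻¹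
  simpa using this

end MinWeighted

/-! ### Relative fair rules satisfy the axioms -/

namespace IsRelativeFair

variable {n : ℕ} {Ω : Type*} [MeasurableSpace Ω] {O : Type*} {R : AggRule n Ω O}
  {M : Set (Fin n → ℝ)}

theorem paretoPrinciple (h : IsRelativeFair R M) : R.ParetoPrinciple := by
  intro X P f g
  simp only [h.rel_iff, P.pref_iff]
  refine ⟨fun hh => minWeighted_mono h.subset_simplex h.isClosed h.nonempty hh, fun hh => ?_⟩
  have := minWeighted_lt h.subset_simplex h.isClosed h.nonempty
    (u := fun i => P.normSEU i g) (v := fun i => P.normSEU i f) fun i => not_le.1 (hh i).2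
  exact ⟨this.le, this.not_ge⟩

theorem continuity (h : IsRelativeFair R M) : R.Continuity := by
  intro X P f g F hF
  have hlim := ((continuous_minWeighted h.subset_simplex h.isClosed h.nonempty).tendsto _).comp hF
  simp only [h.rel_iff]
  exact ⟨fun hh => ge_of_tendsto' hlim hh, fun hh => le_of_tendsto' hlim hh⟩

theorem iie (h : IsRelativeFair R M) : R.IIE := by
  intro X X' P P' hX hP f g
  simp only [h.rel_iff, hP.normSEU_inclAct]

theorem weakPreferenceForMixing (h : IsRelativeFair R M) : R.WeakPreferenceForMixing := by
  intro X P x y E hE hcoin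
  simp only [h.rel_iff, P.normSEU_betAct, P.normSEU_constAct, hcoin _]
  exact min_minWeighted_le h.subset_simplex h.isClosed h.nonempty _ _

theorem beliefIrrelevance (h : IsRelativeFair R M) : R.BeliefIrrelevance := by
  intro X P P' hP x y
  simp only [h.rel_iff, Profile.normSEU_constAct, hP]

theorem restrictedCertaintyIndependence (h : IsRelativeFair R M) :
    R.RestrictedCertaintyIndependence := by
  intro X P hP f g x α hα hα1 f' g' hf hg
  rcases isEmpty_or_nonempty (Fin n) with he | ⟨⟨j⟩⟩
  · simp only [h.rel_iff, Subsingleton.elim (fun i => P.normSEU i g) (fun i => P.normSEU i f),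
      Subsingleton.elim (fun i => P.normSEU i g') (fun i => P.normSEU i f'), le_refl]
  -- The mixing outcome has the same value for all, so both utility vectors undergo one positive
  -- affine map.
  · simp only [h.rel_iff, hf.normSEU_eq, hg.normSEU_eq, hP _ j x]
    rw [minWeighted_affine h.subset_simplex h.isClosed h.nonempty _ hα.le,
      minWeighted_affine h.subset_simplex h.isClosed h.nonempty _ hα.le,
      add_le_add_iff_right, mul_le_mul_iff_right₀ hα]

theorem anonymity (h : IsRelativeFair R M) (hs : SymmetricWeights M) : R.Anonymity := by
  intro X P π f g
  -- `permute` reuses the existence proofs of `P`, so its chosen values and beliefs are those of `P`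
  -- permuted, by definition.
  have e : ∀ f, minWeighted M (fun i => (P.permute π).normSEU i f) =
      minWeighted M (fun i => P.normSEU i f) := fun f =>
    minWeighted_comp_perm hs (fun i => P.normSEU i f) π
  rw [h.rel_iff, h.rel_iff, e, e]

end IsRelativeFair

end FairAgg

/-! ### Maxmin representation of orders on the cube -/

namespace FairAgg

/-- Continuous monotone orders on `[0,1]^n` with a preference for mixing and certainty
independence. -/
structure IsMaxminOrder {n : ℕ} (Q : (Fin n → ℝ) → (Fin n → ℝ) → Prop) : Prop where
  total : ∀ u ∈ Set.Icc 0 1, ∀ v ∈ Set.Icc 0 1, Q u v ∨ Q v u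
  trans : ∀ u ∈ Set.Icc 0 1, ∀ v ∈ Set.Icc 0 1, ∀ w ∈ Set.Icc 0 1, Q u v → Q v w → Q u w
  mono : ∀ u ∈ Set.Icc 0 1, ∀ v ∈ Set.Icc 0 1, v ≤ u → Q u v
  strict : ∀ u ∈ Set.Icc 0 1, ∀ v ∈ Set.Icc 0 1, (∀ i, v i < u i) → ¬ Q v u
  closed_left : ∀ u ∈ Set.Icc 0 1, ∀ v ∈ Set.Icc 0 1, ∀ F : ℕ → Fin n → ℝ,
    (∀ t, F t ∈ Set.Icc 0 1) → Tendsto F atTop (𝓝 u) → (∀ t, Q (F t) v) → Q u v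
  closed_right : ∀ u ∈ Set.Icc 0 1, ∀ v ∈ Set.Icc 0 1, ∀ F : ℕ → Fin n → ℝ,
    (∀ t, F t ∈ Set.Icc 0 1) → Tendsto F atTop (𝓝 u) → (∀ t, Q v (F t)) → Q v u
  mixing : ∀ u ∈ Set.Icc 0 1, ∀ v ∈ Set.Icc 0 1,
    Q (fun i => 1 / 2 * u i + (1 - 1 / 2) * v i) u ∨ Q (fun i => 1 / 2 * u i + (1 - 1 / 2) * v i) v
  certainty : ∀ u ∈ Set.Icc 0 1, ∀ v ∈ Set.Icc 0 1, ∀ c ∈ Set.Icc (0 : ℝ) 1, ∀ α : ℝ,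
    0 < α → α < 1 →
      (Q u v ↔ Q (fun i => α * u i + (1 - α) * c) (fun i => α * v i + (1 - α) * c))

/-- The certainty equivalent of `u`. -/
noncomputable def certEquiv {n : ℕ} (Q : (Fin n → ℝ) → (Fin n → ℝ) → Prop) (u : Fin n → ℝ) : ℝ :=
  sSup {c | c ∈ Set.Icc (0 : ℝ) 1 ∧ Q u fun _ => c}

/-- The positively homogeneous extension of the certainty equivalent to all vectors. -/
noncomputable def certExt {n : ℕ} (Q : (Fin n → ℝ) → (Fin n → ℝ) → Prop) (u : Fin n → ℝ) : ℝ :=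
  (certEquiv Q (fun i => 1 / (2 * (1 + ‖u‖)) * u i + 1 / 2) - 1 / 2) / (1 / (2 * (1 + ‖u‖)))

section Cube

variable {n : ℕ}

theorem const_mem_cube {c : ℝ} (hc : c ∈ Set.Icc (0 : ℝ) 1) :
    (fun _ => c : Fin n → ℝ) ∈ Set.Icc 0 1 :=
  ⟨fun _ => hc.1, fun _ => hc.2⟩

theorem mix_mem_cube {u v : Fin n → ℝ} (hu : u ∈ Set.Icc 0 1) (hv : v ∈ Set.Icc 0 1) {α : ℝ}
    (h0 : 0 ≤ α) (h1 : α ≤ 1) : (fun i => α * u i + (1 - α) * v i) ∈ Set.Icc (0 : Fin n → ℝ) 1 := by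
  refine ⟨fun i => ?_, fun i => ?_⟩
  · exact add_nonneg (mul_nonneg h0 (hu.1 i)) (mul_nonneg (sub_nonneg.2 h1) (hv.1 i))
  · have := mul_le_mul_of_nonneg_left (hu.2 i) h0
    have := mul_le_mul_of_nonneg_left (hv.2 i) (sub_nonneg.2 h1)
    simp only [Pi.one_apply] at *
    linarith

theorem affine_mem_cube {u : Fin n → ℝ} {s : ℝ} (hs : 0 < s) (hsu : s * ‖u‖ ≤ 1 / 2) :
    (fun i => s * u i + 1 / 2) ∈ Set.Icc (0 : Fin n → ℝ) 1 := by
  have h : ∀ i, |s * u i| ≤ 1 / 2 := fun i => by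
    rw [abs_mul, abs_of_pos hs]
    exact (mul_le_mul_of_nonneg_left (norm_le_pi_norm u i) hs.le).trans hsu
  refine ⟨fun i => ?_, fun i => ?_⟩ <;> have := abs_le.1 (h i) <;>
    simp only [Pi.one_apply, Pi.zero_apply] <;> linarith

end Cube

namespace IsMaxminOrder

variable {n : ℕ} {Q : (Fin n → ℝ) → (Fin n → ℝ) → Prop}

theorem const_iff (hQ : IsMaxminOrder Q) {c d : ℝ} (hc : c ∈ Set.Icc (0 : ℝ) 1)
    (hd : d ∈ Set.Icc (0 : ℝ) 1) : Q (fun _ => c) (fun _ => d) ↔ d ≤ c := by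
  refine ⟨fun h => ?_, fun h => hQ.mono _ (const_mem_cube hc) _ (const_mem_cube hd) fun _ => h⟩
  by_contra! hlt
  exact hQ.strict _ (const_mem_cube hd) _ (const_mem_cube hc) (fun _ => hlt) h

theorem bddAbove_certEquiv (u : Fin n → ℝ) :
    BddAbove {c | c ∈ Set.Icc (0 : ℝ) 1 ∧ Q u fun _ => c} :=
  ⟨1, fun _ hc => hc.1.2⟩

theorem zero_mem_certEquiv (hQ : IsMaxminOrder Q) {u : Fin n → ℝ} (hu : u ∈ Set.Icc 0 1) :
    (0 : ℝ) ∈ {c | c ∈ Set.Icc (0 : ℝ) 1 ∧ Q u fun _ => c} :=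
  ⟨by simp, hQ.mono _ hu _ (const_mem_cube (by simp)) hu.1⟩

theorem certEquiv_mem (hQ : IsMaxminOrder Q) {u : Fin n → ℝ} (hu : u ∈ Set.Icc 0 1) :
    certEquiv Q u ∈ Set.Icc (0 : ℝ) 1 :=
  ⟨le_csSup (bddAbove_certEquiv u) (hQ.zero_mem_certEquiv hu),
    csSup_le ⟨0, hQ.zero_mem_certEquiv hu⟩ fun _ hc => hc.1.2⟩

theorem rel_certEquiv (hQ : IsMaxminOrder Q) {u : Fin n → ℝ} (hu : u ∈ Set.Icc 0 1) :
    Q u fun _ => certEquiv Q u := by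
  obtain ⟨c, -, hlim, hc⟩ :=
    exists_seq_tendsto_sSup ⟨0, hQ.zero_mem_certEquiv hu⟩ (bddAbove_certEquiv (Q := Q) u)
  exact hQ.closed_right _ (const_mem_cube (hQ.certEquiv_mem hu)) _ hu (fun t _ => c t)
    (fun t => const_mem_cube (hc t).1) (tendsto_pi_nhds.2 fun _ => hlim) fun t => (hc t).2

theorem certEquiv_rel (hQ : IsMaxminOrder Q) {u : Fin n → ℝ} (hu : u ∈ Set.Icc 0 1) :
    Q (fun _ => certEquiv Q u) u := by
  have hI := hQ.certEquiv_mem hu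
  rcases hI.2.eq_or_lt with h1 | h1
  · exact hQ.mono _ (const_mem_cube hI) _ hu (by rw [h1]; exact hu.2)
  -- Constants strictly above the supremum and tending to it are not weakly below `u`, so by
  -- totality they are weakly above; mixing with `1` keeps them in `[0,1]`.
  set c : ℕ → ℝ := fun t => certEquiv Q u + (1 - certEquiv Q u) * (1 / ((t : ℝ) + 1)) with hcdef
  have hpos : ∀ t : ℕ, 0 < 1 / ((t : ℝ) + 1) := fun t => by positivity
  have hle : ∀ t : ℕ, 1 / ((t : ℝ) + 1) ≤ 1 := fun t => by
    rw [div_le_one (by positivity)]; linarith [(Nat.cast_nonneg t : (0 : ℝ) ≤ t)]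
  have hlt : ∀ t, certEquiv Q u < c t := fun t =>
    lt_add_of_pos_right _ (mul_pos (sub_pos.2 h1) (hpos t))
  have hc : ∀ t, c t ∈ Set.Icc (0 : ℝ) 1 := fun t => ⟨hI.1.trans (hlt t).le, by
    have := mul_le_mul_of_nonneg_left (hle t) (sub_pos.2 h1).le
    linarith⟩
  have hlim : Tendsto c atTop (𝓝 (certEquiv Q u)) := by
    have := (tendsto_one_div_add_atTop_nhds_zero_nat (𝕜 := ℝ)).const_mul (1 - certEquiv Q u)
    simpa [hcdef] using this.const_add (certEquiv Q u)
  refine hQ.closed_left _ (const_mem_cube hI) _ hu (fun t _ => c t)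
    (fun t => const_mem_cube (hc t)) (tendsto_pi_nhds.2 fun _ => hlim) fun t => ?_
  refine (hQ.total _ hu _ (const_mem_cube (hc t))).resolve_left fun h => ?_
  exact (le_csSup (bddAbove_certEquiv u) ⟨hc t, h⟩).not_gt (hlt t)

theorem rel_iff (hQ : IsMaxminOrder Q) {u v : Fin n → ℝ} (hu : u ∈ Set.Icc 0 1)
    (hv : v ∈ Set.Icc 0 1) : Q u v ↔ certEquiv Q v ≤ certEquiv Q u := by
  have hcu := const_mem_cube (n := n) (hQ.certEquiv_mem hu)
  have hcv := const_mem_cube (n := n) (hQ.certEquiv_mem hv)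
  rw [← hQ.const_iff (hQ.certEquiv_mem hu) (hQ.certEquiv_mem hv)]
  constructor
  · intro h
    exact hQ.trans _ hcu _ hu _ hcv (hQ.certEquiv_rel hu)
      (hQ.trans _ hu _ hv _ hcv h (hQ.rel_certEquiv hv))
  · intro h
    exact hQ.trans _ hu _ hcu _ hv (hQ.rel_certEquiv hu)
      (hQ.trans _ hcu _ hcv _ hv h (hQ.certEquiv_rel hv))

theorem certEquiv_const (hQ : IsMaxminOrder Q) {c : ℝ} (hc : c ∈ Set.Icc (0 : ℝ) 1) :
    certEquiv Q (fun _ => c) = c := by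
  have hcc := const_mem_cube (n := n) hc
  have hI := hQ.certEquiv_mem hcc
  exact le_antisymm ((hQ.const_iff hc hI).1 (hQ.rel_certEquiv hcc))
    ((hQ.const_iff hI hc).1 (hQ.certEquiv_rel hcc))

theorem certEquiv_eq (hQ : IsMaxminOrder Q) {u : Fin n → ℝ} (hu : u ∈ Set.Icc 0 1) {c : ℝ}
    (hc : c ∈ Set.Icc (0 : ℝ) 1) (h1 : Q u fun _ => c) (h2 : Q (fun _ => c) u) :
    certEquiv Q u = c := by
  rw [hQ.rel_iff hu (const_mem_cube hc), hQ.certEquiv_const hc] at h1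
  rw [hQ.rel_iff (const_mem_cube hc) hu, hQ.certEquiv_const hc] at h2
  exact le_antisymm h2 h1

theorem certEquiv_mono (hQ : IsMaxminOrder Q) {u v : Fin n → ℝ} (hu : u ∈ Set.Icc 0 1)
    (hv : v ∈ Set.Icc 0 1) (h : v ≤ u) : certEquiv Q v ≤ certEquiv Q u :=
  (hQ.rel_iff hu hv).1 (hQ.mono _ hu _ hv h)

theorem certEquiv_mix_const (hQ : IsMaxminOrder Q) {u : Fin n → ℝ} (hu : u ∈ Set.Icc 0 1) {c : ℝ}
    (hc : c ∈ Set.Icc (0 : ℝ) 1) {α : ℝ} (h0 : 0 < α) (h1 : α < 1) :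
    certEquiv Q (fun i => α * u i + (1 - α) * c) = α * certEquiv Q u + (1 - α) * c := by
  have hI := hQ.certEquiv_mem hu
  have hIc := const_mem_cube (n := n) hI
  have hm : α * certEquiv Q u + (1 - α) * c ∈ Set.Icc (0 : ℝ) 1 :=
    convex_Icc (0 : ℝ) 1 hI hc h0.le (sub_nonneg.2 h1.le) (by ring)
  exact hQ.certEquiv_eq (mix_mem_cube hu (const_mem_cube hc) h0.le h1.le) hm
    ((hQ.certainty _ hu _ hIc c hc α h0 h1).1 (hQ.rel_certEquiv hu))
    ((hQ.certainty _ hIc _ hu c hc α h0 h1).1 (hQ.certEquiv_rel hu))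

/-- Mixing `v` with the constant `d` and `u` with `0` equalizes the certainty equivalents, so both
alternatives in the mixing axiom give the same bound. The shift is then removed from the midpoint.
-/
theorem certEquiv_midpoint_of_le (hQ : IsMaxminOrder Q) {u v : Fin n → ℝ} (hu : u ∈ Set.Icc 0 1)
    (hv : v ∈ Set.Icc 0 1) (hle : certEquiv Q v ≤ certEquiv Q u) :
    (certEquiv Q u + certEquiv Q v) / 2 ≤
      certEquiv Q (fun i => 1 / 2 * u i + (1 - 1 / 2) * v i) := by
  have hIu := hQ.certEquiv_mem hu
  have hIv := hQ.certEquiv_mem hv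
  set d := certEquiv Q u - certEquiv Q v with hd
  have hd' : d ∈ Set.Icc (0 : ℝ) 1 := ⟨by linarith, by linarith [hIu.2, hIv.1]⟩
  have hd2 : d / 2 ∈ Set.Icc (0 : ℝ) 1 := ⟨by linarith [hd'.1], by linarith [hd'.2, hd'.1]⟩
  have h0 : (0 : ℝ) ∈ Set.Icc (0 : ℝ) 1 := by simp
  have hmid := mix_mem_cube hu hv (by norm_num : (0 : ℝ) ≤ 1 / 2) (by norm_num)
  have hu' := mix_mem_cube hu (const_mem_cube h0) (by norm_num : (0 : ℝ) ≤ 1 / 2) (by norm_num)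
  have hv' := mix_mem_cube hv (const_mem_cube hd') (by norm_num : (0 : ℝ) ≤ 1 / 2) (by norm_num)
  have e1 := hQ.certEquiv_mix_const hu h0 (by norm_num : (0 : ℝ) < 1 / 2) (by norm_num)
  have e2 := hQ.certEquiv_mix_const hv hd' (by norm_num : (0 : ℝ) < 1 / 2) (by norm_num)
  have e3 := hQ.certEquiv_mix_const hmid hd2 (by norm_num : (0 : ℝ) < 1 / 2) (by norm_num)
  have hm' := mix_mem_cube hu' hv' (by norm_num : (0 : ℝ) ≤ 1 / 2) (by norm_num)
  have heq : (fun i => 1 / 2 * (1 / 2 * u i + (1 - 1 / 2) * 0) +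
      (1 - 1 / 2) * (1 / 2 * v i + (1 - 1 / 2) * d)) =
      fun i => 1 / 2 * (1 / 2 * u i + (1 - 1 / 2) * v i) + (1 - 1 / 2) * (d / 2) := by
    funext i; ring
  have hmix := hQ.mixing _ hu' _ hv'
  rw [hQ.rel_iff hm' hu', hQ.rel_iff hm' hv', heq, e1, e2, e3] at hmix
  rcases hmix with h | h <;> linarith

theorem certEquiv_midpoint (hQ : IsMaxminOrder Q) {u v : Fin n → ℝ} (hu : u ∈ Set.Icc 0 1)
    (hv : v ∈ Set.Icc 0 1) : (certEquiv Q u + certEquiv Q v) / 2 ≤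
      certEquiv Q (fun i => 1 / 2 * u i + (1 - 1 / 2) * v i) := by
  rcases le_total (certEquiv Q v) (certEquiv Q u) with h | h
  · exact hQ.certEquiv_midpoint_of_le hu hv h
  · have := hQ.certEquiv_midpoint_of_le hv hu h
    have e : (fun i => 1 / 2 * v i + (1 - 1 / 2) * u i) =
        fun i => 1 / 2 * u i + (1 - 1 / 2) * v i := by funext i; ring
    rw [e] at this
    linarith

/-- The vector at scale `s` is the mixture, with weight `s / t`, of the vector at scale `t` and the
constant `1 / 2`. -/
theorem certEquiv_affine_of_lt (hQ : IsMaxminOrder Q) {u : Fin n → ℝ} {s t : ℝ} (hs : 0 < s)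
    (hst : s < t) (htu : t * ‖u‖ ≤ 1 / 2) :
    t * (certEquiv Q (fun i => s * u i + 1 / 2) - 1 / 2) =
      s * (certEquiv Q (fun i => t * u i + 1 / 2) - 1 / 2) := by
  have ht := hs.trans hst
  have e := hQ.certEquiv_mix_const (affine_mem_cube ht htu) (c := 1 / 2)
    ⟨by norm_num, by norm_num⟩ (div_pos hs ht) ((div_lt_one ht).2 hst)
  have e' : (fun i => s / t * (t * u i + 1 / 2) + (1 - s / t) * (1 / 2)) =
      fun i => s * u i + 1 / 2 := by
    funext i; linear_combination u i * div_mul_cancel₀ s ht.ne'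
  rw [e'] at e
  rw [e]
  linear_combination
    (certEquiv Q (fun i => t * u i + 1 / 2) - 1 / 2) * div_mul_cancel₀ s ht.ne'

/-- The scale in the definition of `certExt` is immaterial: any scale that keeps the vector in the
cube around `1 / 2` gives the same slope. -/
theorem certEquiv_affine (hQ : IsMaxminOrder Q) {u : Fin n → ℝ} {s : ℝ} (hs : 0 < s)
    (hsu : s * ‖u‖ ≤ 1 / 2) :
    certEquiv Q (fun i => s * u i + 1 / 2) = 1 / 2 + s * certExt Q u := by
  have hn := norm_nonneg u
  set t : ℝ := 1 / (2 * (1 + ‖u‖)) with ht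
  have ht0 : 0 < t := by positivity
  have htu : t * ‖u‖ ≤ 1 / 2 := by
    rw [ht, div_mul_eq_mul_div, div_le_div_iff₀ (by positivity) (by norm_num)]
    linarith
  have key : t * (certEquiv Q (fun i => s * u i + 1 / 2) - 1 / 2) =
      s * (certEquiv Q (fun i => t * u i + 1 / 2) - 1 / 2) := by
    rcases lt_trichotomy s t with h | h | h
    · exact hQ.certEquiv_affine_of_lt hs h htu
    · rw [h]
    · exact (hQ.certEquiv_affine_of_lt ht0 h hsu).symm
  rw [certExt, ← ht, mul_div_assoc', ← key, mul_div_cancel_left₀ _ ht0.ne']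
  ring

theorem exists_scale (a b : ℝ) (ha : 0 ≤ a) (hb : 0 ≤ b) :
    ∃ s : ℝ, 0 < s ∧ s * a ≤ 1 / 2 ∧ s * b ≤ 1 / 2 := by
  refine ⟨1 / (2 * (1 + a + b)), by positivity, ?_, ?_⟩ <;>
  · rw [div_mul_eq_mul_div, div_le_div_iff₀ (by positivity) (by norm_num)]
    linarith

theorem certExt_smul (hQ : IsMaxminOrder Q) {c : ℝ} (hc : 0 < c) (u : Fin n → ℝ) :
    certExt Q (c • u) = c * certExt Q u := by
  obtain ⟨s, hs, h1, -⟩ := exists_scale ‖c • u‖ 0 (norm_nonneg _) le_rfl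
  have e1 := hQ.certEquiv_affine hs h1
  rw [norm_smul, Real.norm_of_nonneg hc.le, ← mul_assoc] at h1
  have e2 := hQ.certEquiv_affine (mul_pos hs hc) h1
  simp only [Pi.smul_apply, smul_eq_mul, ← mul_assoc] at e1
  rw [e1] at e2
  have : s * certExt Q (c • u) = s * (c * certExt Q u) := by linarith
  exact mul_left_cancel₀ hs.ne' this

/-- Midpoint concavity near the centre of the cube becomes superadditivity by homogeneity. -/
theorem le_certExt_add (hQ : IsMaxminOrder Q) (u v : Fin n → ℝ) :
    certExt Q u + certExt Q v ≤ certExt Q (u + v) := by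
  obtain ⟨s, hs, h1, h2⟩ := exists_scale ‖u‖ ‖v‖ (norm_nonneg _) (norm_nonneg _)
  have h3 : s / 2 * ‖u + v‖ ≤ 1 / 2 := by
    have := mul_le_mul_of_nonneg_left (norm_add_le u v) (half_pos hs).le
    linarith
  have hm := hQ.certEquiv_midpoint (affine_mem_cube hs h1) (affine_mem_cube hs h2)
  have e : (fun i => 1 / 2 * (s * u i + 1 / 2) + (1 - 1 / 2) * (s * v i + 1 / 2)) =
      fun i => s / 2 * (u + v) i + 1 / 2 := by
    funext i; simp only [Pi.add_apply]; ring
  rw [e, hQ.certEquiv_affine hs h1, hQ.certEquiv_affine hs h2,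
    hQ.certEquiv_affine (half_pos hs) h3] at hm
  have : s * (certExt Q u + certExt Q v) ≤ s * certExt Q (u + v) := by linarith
  exact le_of_mul_le_mul_left this hs

theorem certExt_nonneg (hQ : IsMaxminOrder Q) {u : Fin n → ℝ} (hu : 0 ≤ u) : 0 ≤ certExt Q u := by
  obtain ⟨s, hs, h1, -⟩ := exists_scale ‖u‖ 0 (norm_nonneg _) le_rfl
  have hh : (1 / 2 : ℝ) ∈ Set.Icc (0 : ℝ) 1 := ⟨by norm_num, by norm_num⟩
  have hm := hQ.certEquiv_mono (affine_mem_cube hs h1) (const_mem_cube hh)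
    fun i => le_add_of_nonneg_left (mul_nonneg hs.le (hu i))
  rw [hQ.certEquiv_const hh, hQ.certEquiv_affine hs h1] at hm
  exact nonneg_of_mul_nonneg_right (by linarith : 0 ≤ s * certExt Q u) hs

theorem certExt_eq (hQ : IsMaxminOrder Q) {u : Fin n → ℝ} (hu : u ∈ Set.Icc 0 1) :
    certExt Q u = certEquiv Q u := by
  have hn : ‖u‖ ≤ 1 := (pi_norm_le_iff_of_nonneg zero_le_one).2 fun i => by
    rw [Real.norm_of_nonneg (hu.1 i)]; exact hu.2 i
  have e1 := hQ.certEquiv_affine (u := u) (by norm_num : (0 : ℝ) < 1 / 2) (by linarith)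
  have e2 := hQ.certEquiv_mix_const hu (c := 1) (by simp) (by norm_num : (0 : ℝ) < 1 / 2)
    (by norm_num)
  have e : (fun i => 1 / 2 * u i + (1 - 1 / 2) * 1) = fun i => 1 / 2 * u i + 1 / 2 := by
    funext i; ring
  rw [e, e1] at e2
  linarith

theorem certExt_const (hQ : IsMaxminOrder Q) {c : ℝ} (hc : |c| ≤ 1) :
    certExt Q (fun _ => c) = c := by
  have hn : ‖(fun _ => c : Fin n → ℝ)‖ ≤ 1 :=
    (pi_norm_le_iff_of_nonneg zero_le_one).2 fun i => hc
  have e1 := hQ.certEquiv_affine (u := fun _ => c) (by norm_num : (0 : ℝ) < 1 / 2) (by linarith)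
  have := abs_le.1 hc
  rw [hQ.certEquiv_const ⟨by linarith, by linarith⟩] at e1
  linarith

theorem certExt_zero (hQ : IsMaxminOrder Q) : certExt Q 0 = 0 :=
  hQ.certExt_const (c := 0) (by simp)

/-- The weights under which no vector is worth less than its certainty equivalent. -/
def weights (Q : (Fin n → ℝ) → (Fin n → ℝ) → Prop) : Set (Fin n → ℝ) :=
  stdSimplex ℝ (Fin n) ∩ ⋂ u ∈ Set.Icc (0 : Fin n → ℝ) 1, {μ | certEquiv Q u ≤ ∑ i, μ i * u i}

theorem mem_weights {μ : Fin n → ℝ} : μ ∈ weights Q ↔ μ ∈ stdSimplex ℝ (Fin n) ∧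
    ∀ u ∈ Set.Icc (0 : Fin n → ℝ) 1, certEquiv Q u ≤ ∑ i, μ i * u i := by
  simp only [weights, Set.mem_inter_iff, Set.mem_iInter, Set.mem_ofPred_eq]

theorem isClosed_weights : IsClosed (weights Q) :=
  (isClosed_stdSimplex ℝ (Fin n)).inter (isClosed_biInter fun u _ =>
    isClosed_le continuous_const (by fun_prop))

theorem convex_weights : Convex ℝ (weights Q) := by
  refine (convex_stdSimplex _ _).inter (convex_iInter₂ fun u _ => ?_)
  exact convex_halfSpace_ge (f := fun μ : Fin n → ℝ => ∑ i, μ i * u i)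
    ⟨fun μ ν => by simp [add_mul, Finset.sum_add_distrib],
      fun c μ => by simp [mul_assoc, Finset.mul_sum]⟩ _

/-- Supporting weights exist at every vector. -/
theorem exists_mem_weights (hQ : IsMaxminOrder Q) {u : Fin n → ℝ} (hu : u ∈ Set.Icc 0 1) :
    ∃ μ ∈ weights Q, ∑ i, μ i * u i = certEquiv Q u := by
  have hwd : ∀ c : ℝ, c • u = 0 → c • certExt Q u = 0 := by
    intro c hc
    rcases smul_eq_zero.1 hc with h | h
    · rw [h, zero_smul]
    · rw [h, hQ.certExt_zero, smul_zero]
  -- This is the domination required by Hahn–Banach on positive multiples of `u`; on negative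
  -- multiples equality holds.
  have hsum : certExt Q u + certExt Q (-u) ≤ 0 := by
    have := hQ.le_certExt_add u (-u)
    rwa [add_neg_cancel, hQ.certExt_zero] at this
  -- The sublinear majorant is `x ↦ -certExt Q (-x)`; being below it is the same as being above
  -- `certExt Q`.
  obtain ⟨g, hg1, hg2⟩ := exists_extension_of_le_sublinear
    (LinearPMap.mkSpanSingleton' (σ := RingHom.id ℝ) u (certExt Q u) hwd) (fun x => -certExt Q (-x))
    (fun c hc x => by rw [← smul_neg, hQ.certExt_smul hc]; ring)
    (fun x y => by
      have := hQ.le_certExt_add (-x) (-y)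
      rw [neg_add]; linarith)
    (by
      rintro ⟨x, hx⟩
      obtain ⟨c, rfl⟩ := Submodule.mem_span_singleton.1 hx
      rw [LinearPMap.mkSpanSingleton'_apply]
      simp only [RingHom.id_apply, smul_eq_mul]
      rcases lt_trichotomy c 0 with h | h | h
      · rw [← neg_smul, hQ.certExt_smul (neg_pos.2 h)]; linarith
      · simp [h, hQ.certExt_zero]
      · rw [← smul_neg, hQ.certExt_smul h]; nlinarith)
  have hge : ∀ x, certExt Q x ≤ g x := fun x => by
    have := hg2 (-x)
    rw [neg_neg, map_neg] at this
    linarith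
  have hgu : g u = certExt Q u := by
    have hu' : u ∈ (LinearPMap.mkSpanSingleton' (σ := RingHom.id ℝ) u (certExt Q u) hwd).domain :=
      Submodule.mem_span_singleton_self u
    have h1 := hg1 ⟨u, hu'⟩
    have h2 := LinearPMap.mkSpanSingleton'_apply_self u (certExt Q u) hwd hu'
    exact h1.trans h2
  have hgs : ∀ x : Fin n → ℝ, ∑ i, g (Pi.single i 1) * x i = g x := by
    intro x
    conv_rhs => rw [pi_eq_sum_univ' x]
    rw [map_sum]
    exact Finset.sum_congr rfl fun i _ => by rw [map_smul, smul_eq_mul, mul_comm]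
  refine ⟨fun i => g (Pi.single i 1), mem_weights.2 ⟨⟨fun i => ?_, ?_⟩, fun v hv => ?_⟩, ?_⟩
  · exact (hQ.certExt_nonneg (Pi.single_nonneg.2 zero_le_one)).trans (hge _)
  -- The constants `1` and `-1` bound the total weight from both sides.
  · have h1 := hge fun _ => 1
    have h2 := hge fun _ => -1
    rw [hQ.certExt_const (by simp), ← hgs] at h1 h2
    simp only [mul_one, mul_neg, Finset.sum_neg_distrib] at h1 h2
    linarith
  · rw [hgs, ← hQ.certExt_eq hv]
    exact hge v
  · rw [hgs, hgu, hQ.certExt_eq hu]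

theorem minWeighted_weights (hQ : IsMaxminOrder Q) {u : Fin n → ℝ} (hu : u ∈ Set.Icc 0 1) :
    minWeighted (weights Q) u = certEquiv Q u := by
  obtain ⟨μ, hμ, he⟩ := hQ.exists_mem_weights hu
  have : IsLeast ((fun μ : Fin n → ℝ => ∑ i, μ i * u i) '' weights Q) (certEquiv Q u) :=
    ⟨⟨μ, hμ, he⟩, by rintro _ ⟨ν, hν, rfl⟩; exact (mem_weights.1 hν).2 u hu⟩
  exact this.csInf_eq

/-- The certainty equivalent is permutation invariant, so a permutation of the weights can be moved
to the utilities. -/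
theorem symmetricWeights (hQ : IsMaxminOrder Q)
    (hs : ∀ u ∈ Set.Icc 0 1, ∀ v ∈ Set.Icc 0 1, ∀ π : Equiv.Perm (Fin n),
      Q u v → Q (fun i => u (π i)) (fun i => v (π i))) :
    SymmetricWeights (weights Q) := by
  have hI : ∀ u ∈ Set.Icc (0 : Fin n → ℝ) 1, ∀ π : Equiv.Perm (Fin n),
      certEquiv Q (fun i => u (π i)) = certEquiv Q u := fun u hu π =>
    hQ.certEquiv_eq (u := fun i => u (π i)) ⟨fun i => hu.1 (π i), fun i => hu.2 (π i)⟩ (hQ.certEquiv_mem hu)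
      (hs _ hu _ (const_mem_cube (hQ.certEquiv_mem hu)) π (hQ.rel_certEquiv hu))
      (hs _ (const_mem_cube (hQ.certEquiv_mem hu)) _ hu π (hQ.certEquiv_rel hu))
  intro μ hμ π
  rw [mem_weights] at hμ ⊢
  refine ⟨⟨fun i => hμ.1.1 _, (Equiv.sum_comp π μ).trans hμ.1.2⟩, fun u hu => ?_⟩
  rw [← hI u hu π⁻¹]
  refine (hμ.2 (fun i => u (π⁻¹ i)) ⟨fun i => hu.1 (π⁻¹ i), fun i => hu.2 (π⁻¹ i)⟩).trans_eq ?_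
  exact (Fintype.sum_equiv π _ _ fun i => by simp).symm

end IsMaxminOrder

end FairAgg

/-! ### Realization of utility vectors and reduction to a single order -/

namespace FairAgg

variable {n : ℕ} {Ω : Type*} [MeasurableSpace Ω] {O : Type*} {X Y Z : FeasibleSet O}

theorem exists_inclAct_eq (h : Y.carrier ⊆ X.carrier) (f : Act Ω X)
    (hf : ∀ ω, (f ω).1 ∈ Y.carrier) : ∃ g : Act Ω Y, inclAct h g = f := by
  classical
  obtain ⟨y, hy⟩ := Y.nontrivial.nonempty
  refine ⟨f.map fun x => if hx : x.1 ∈ Y.carrier then ⟨x.1, hx⟩ else ⟨y, hy⟩, ?_⟩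
  ext ω
  simp [inclAct, hf ω]

/-- The union of two feasible sets. -/
def FeasibleSet.union (Y Z : FeasibleSet O) : FeasibleSet O where
  carrier := Y.carrier ∪ Z.carrier
  countable := Y.countable.union Z.countable
  nontrivial := Y.nontrivial.mono Set.subset_union_left

theorem FeasibleSet.subset_union_left : Y.carrier ⊆ (Y.union Z).carrier :=
  Set.subset_union_left

theorem FeasibleSet.subset_union_right : Z.carrier ⊆ (Y.union Z).carrier :=
  Set.subset_union_right

namespace Profile

/-- A problem restricts to any feasible subset containing best and worst outcomes of everyone. -/
theorem exists_restriction (P : Profile n Ω X) (h : Y.carrier ⊆ X.carrier)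
    (hb : ∀ i, ∃ y : Y.carrier, P.normValue i (Set.inclusion h y) = 1)
    (hw : ∀ i, ∃ y : Y.carrier, P.normValue i (Set.inclusion h y) = 0) :
    ∃ P' : Profile n Ω Y, P'.IsInessentialExpansion P h := by
  have hN : ∀ i, IsNormalized fun y => P.normValue i (Set.inclusion h y) := fun i =>
    ⟨fun y => (P.isNormalized_normValue i).nonneg _, fun y => (P.isNormalized_normValue i).le_one _,
      hb i, hw i⟩
  refine ⟨ofNormalized _ P.belief hN (fun i => inferInstance) P.nonatomic_belief, ?_⟩
  rw [isInessentialExpansion_iff]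
  exact ⟨fun i => (belief_ofNormalized i).symm, fun i x => by rw [normValue_ofNormalized]⟩

/-- Every comparison of two acts can be made in a finite problem. -/
theorem exists_finite_restriction [NeZero n] (P : Profile n Ω X) (f g : Act Ω X) :
    ∃ (Y : FeasibleSet O) (h : Y.carrier ⊆ X.carrier) (P' : Profile n Ω Y) (f' g' : Act Ω Y),
      Y.carrier.Finite ∧ P'.IsInessentialExpansion P h ∧ inclAct h f' = f ∧ inclAct h g' = g := by
  choose b hb using fun i => (P.isNormalized_normValue i).exists_eq_one
  choose w hw using fun i => (P.isNormalized_normValue i).exists_eq_zero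
  -- Keeping a best and a worst outcome of each individual makes the passage back to `X`
  -- inessential.
  let S : Set X.carrier := Set.range f ∪ Set.range g ∪ Set.range b ∪ Set.range w
  have hS : S.Finite := ((f.finite_range.union g.finite_range).union (Set.finite_range b)).union
    (Set.finite_range w)
  have hmem : ∀ x ∈ S, x.1 ∈ Subtype.val '' S := fun x hx => ⟨x, hx, rfl⟩
  have hbS : ∀ i, b i ∈ S := fun i => Or.inl (Or.inr ⟨i, rfl⟩)
  have hwS : ∀ i, w i ∈ S := fun i => Or.inr ⟨i, rfl⟩
  have hne : (b 0).1 ≠ (w 0).1 := by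
    intro he
    have h1 := hb 0
    rw [Subtype.ext he, hw 0] at h1
    exact zero_ne_one h1
  let Y : FeasibleSet O := ⟨Subtype.val '' S, (hS.image _).countable,
    ⟨_, hmem _ (hbS 0), _, hmem _ (hwS 0), hne⟩⟩
  have h : Y.carrier ⊆ X.carrier := by
    rintro _ ⟨x, -, rfl⟩
    exact x.2
  obtain ⟨P', hP'⟩ := P.exists_restriction h (fun i => ⟨⟨_, hmem _ (hbS i)⟩, hb i⟩)
    fun i => ⟨⟨_, hmem _ (hwS i)⟩, hw i⟩
  obtain ⟨f', hf'⟩ := exists_inclAct_eq h f fun ω =>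
    hmem _ (Or.inl (Or.inl (Or.inl ⟨ω, rfl⟩)))
  obtain ⟨g', hg'⟩ := exists_inclAct_eq h g fun ω =>
    hmem _ (Or.inl (Or.inl (Or.inr ⟨ω, rfl⟩)))
  exact ⟨Y, h, P', f', g', hS.image _, hP', hf', hg'⟩

/-- Problems with the same beliefs over disjoint feasible sets have a common inessential
expansion. -/
theorem exists_join (P : Profile n Ω Y) (P' : Profile n Ω Z) (hd : Disjoint Y.carrier Z.carrier)
    (hb : ∀ i, P.belief i = P'.belief i) :
    ∃ J : Profile n Ω (Y.union Z), P.IsInessentialExpansion J FeasibleSet.subset_union_left ∧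
      P'.IsInessentialExpansion J FeasibleSet.subset_union_right := by
  classical
  let w : Fin n → (Y.union Z).carrier → ℝ := fun i o =>
    if h : o.1 ∈ Y.carrier then P.normValue i ⟨o.1, h⟩
    else P'.normValue i ⟨o.1, o.2.resolve_left h⟩
  have hwY : ∀ i y, w i (Set.inclusion FeasibleSet.subset_union_left y) = P.normValue i y := fun i y =>
    dif_pos y.2
  have hwZ : ∀ i z, w i (Set.inclusion FeasibleSet.subset_union_right z) = P'.normValue i z := fun i z =>
    dif_neg fun h => Set.disjoint_left.1 hd h z.2
  have hN : ∀ i, IsNormalized (w i) := by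
    intro i
    refine ⟨fun x => ?_, fun x => ?_, ?_, ?_⟩
    · dsimp only [w]
      split_ifs
      exacts [(P.isNormalized_normValue i).nonneg _, (P'.isNormalized_normValue i).nonneg _]
    · dsimp only [w]
      split_ifs
      exacts [(P.isNormalized_normValue i).le_one _, (P'.isNormalized_normValue i).le_one _]
    · obtain ⟨b, hb⟩ := (P.isNormalized_normValue i).exists_eq_one
      exact ⟨_, (hwY i b).trans hb⟩
    · obtain ⟨b, hb⟩ := (P.isNormalized_normValue i).exists_eq_zero
      exact ⟨_, (hwY i b).trans hb⟩
  refine ⟨ofNormalized w P.belief hN (fun i => inferInstance) P.nonatomic_belief, ?_, ?_⟩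
  · rw [isInessentialExpansion_iff]
    exact ⟨belief_ofNormalized, fun i x => by rw [normValue_ofNormalized]; exact hwY i x⟩
  · rw [isInessentialExpansion_iff]
    exact ⟨fun i => (belief_ofNormalized i).trans (hb i),
      fun i x => by rw [normValue_ofNormalized]; exact hwZ i x⟩

/-- Any countable family of vectors of normalized values that includes the constant vectors `0` and
`1` is realized by the outcomes of some problem with prescribed beliefs. -/
theorem exists_realization [NeZero n] [Infinite O] {ι : Type*} [Countable ι] (u : ι → Fin n → ℝ)
    (hu : ∀ t, u t ∈ Set.Icc 0 1) (h1 : ∃ t, u t = 1) (h0 : ∃ t, u t = 0)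
    (p : Fin n → Measure Ω) (hp : ∀ i, IsProbabilityMeasure (p i)) (hna : ∀ i, Nonatomic (p i)) :
    ∃ (X : FeasibleSet O) (P : Profile n Ω X) (x : ι ≃ X.carrier), (∀ i, P.belief i = p i) ∧
      ∀ t i, P.normValue i (x t) = u t i := by
  obtain ⟨t1, h1⟩ := h1
  obtain ⟨t0, h0⟩ := h0
  obtain ⟨e0, he0⟩ := exists_injective_nat ι
  have he : Function.Injective fun t => Infinite.natEmbedding O (e0 t) :=
    (Infinite.natEmbedding O).injective.comp he0
  set e := fun t => Infinite.natEmbedding O (e0 t)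
  have hne : t1 ≠ t0 := by
    rintro rfl
    have := congrFun (h1.symm.trans h0) 0
    exact one_ne_zero this
  let X : FeasibleSet O := ⟨Set.range e, Set.countable_range e,
    ⟨e t1, ⟨t1, rfl⟩, e t0, ⟨t0, rfl⟩, fun h => hne (he h)⟩⟩
  let x : ι ≃ X.carrier := Equiv.ofInjective e he
  have hN : ∀ i, IsNormalized fun y => u (x.symm y) i := fun i =>
    ⟨fun y => (hu _).1 i, fun y => (hu _).2 i, ⟨x t1, by simp [h1]⟩, ⟨x t0, by simp [h0]⟩⟩
  refine ⟨X, ofNormalized (fun i y => u (x.symm y) i) p hN hp hna, x,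
    belief_ofNormalized, fun t i => ?_⟩
  rw [normValue_ofNormalized, Equiv.symm_apply_apply]

/-- Any countable set of vectors in `[0,1]^n` is realized by the outcomes of some problem. -/
theorem exists_realization_set [NeZero n] [Infinite O] {S : Set (Fin n → ℝ)} (hS : S.Countable)
    (hS1 : S ⊆ Set.Icc 0 1) {p : Measure Ω} (hp : IsProbabilityMeasure p) (hna : Nonatomic p) :
    ∃ (X : FeasibleSet O) (P : Profile n Ω X) (x : S → X.carrier), (∀ i, P.belief i = p) ∧
      ∀ s i, P.normValue i (x s) = s.1 i := by
  have : Countable ↥(S ∪ {0, 1}) := (hS.union (Set.toFinite _).countable).to_subtype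
  obtain ⟨X, P, x, hb, hx⟩ := exists_realization (O := O) (fun s : ↥(S ∪ {0, 1}) => s.1)
    (by
      rintro ⟨s, hs | rfl | rfl⟩
      exacts [hS1 hs, ⟨le_rfl, zero_le_one⟩, ⟨zero_le_one, le_rfl⟩])
    ⟨⟨1, by simp⟩, rfl⟩ ⟨⟨0, by simp⟩, rfl⟩ (fun _ => p) (fun _ => hp) fun _ => hna
  exact ⟨X, P, fun s => x ⟨s.1, Or.inl s.2⟩, hb, fun s i => hx _ i⟩

end Profile

namespace AggRule

variable {R : AggRule n Ω O}

/-- The order over vectors of normalized utilities induced by an aggregation rule. -/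
def socialOrder (R : AggRule n Ω O) (u v : Fin n → ℝ) : Prop :=
  ∃ (X : FeasibleSet O) (P : Profile n Ω X) (f g : Act Ω X),
    (fun i => P.normSEU i f) = u ∧ (fun i => P.normSEU i g) = v ∧ R.rel P f g

theorem ParetoPrinciple.rel_congr (h : R.ParetoPrinciple) (P : Profile n Ω X)
    {f f' g g' : Act Ω X} (hf : ∀ i, P.normSEU i f = P.normSEU i f')
    (hg : ∀ i, P.normSEU i g = P.normSEU i g') : R.rel P f g ↔ R.rel P f' g' := by
  have key : ∀ {a b : Act Ω X}, (∀ i, P.normSEU i a = P.normSEU i b) → R.rel P a b :=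
    fun {a b} hab => (h X P a b).1 fun i => (P.pref_iff i a b).2 (hab i).ge
  exact ⟨fun hr => R.transitive P _ _ _ (key fun i => (hf i).symm)
      (R.transitive P _ _ _ hr (key hg)),
    fun hr => R.transitive P _ _ _ (key hf) (R.transitive P _ _ _ hr (key fun i => (hg i).symm))⟩

/-- A comparison of acts equals the comparison of outcomes with the same utilities in any problem
with the same beliefs over new outcomes. -/
theorem rel_iff_rel_const [NeZero n] (hP : R.ParetoPrinciple) (hI : R.IIE) (P : Profile n Ω X)
    (f g : Act Ω X) :
    ∃ S : Set O, S.Finite ∧ ∀ (Z : FeasibleSet O) (P' : Profile n Ω Z) (a b : Z.carrier),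
      Disjoint S Z.carrier → (∀ i, P.belief i = P'.belief i) →
      (∀ i, P'.normValue i a = P.normSEU i f) → (∀ i, P'.normValue i b = P.normSEU i g) →
      (R.rel P f g ↔ R.rel P' (constAct Ω a) (constAct Ω b)) := by
  obtain ⟨Y, hYX, P0, f0, g0, hYf, hexp, hf0, hg0⟩ := P.exists_finite_restriction f g
  refine ⟨Y.carrier, hYf, fun Z P' a b hd hbel ha hb => ?_⟩
  have hb0 := ((P0.isInessentialExpansion_iff P hYX).1 hexp).1
  obtain ⟨J, hJ, hJ'⟩ := P0.exists_join P' hd fun i => (hb0 i).symm.trans (hbel i)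
  have hf1 : ∀ i, P0.normSEU i f0 = P.normSEU i f := fun i => by
    rw [← hf0, hexp.normSEU_inclAct]
  have hg1 : ∀ i, P0.normSEU i g0 = P.normSEU i g := fun i => by
    rw [← hg0, hexp.normSEU_inclAct]
  have e1 := hI Y X P0 P hYX hexp f0 g0
  rw [hf0, hg0] at e1
  rw [e1, ← hI Y _ P0 J _ hJ f0 g0, ← hI Z _ P' J _ hJ']
  refine hP.rel_congr J (fun i => ?_) fun i => ?_
  · rw [hJ.normSEU_inclAct, hJ'.normSEU_inclAct, hf1, Profile.normSEU_constAct, ha]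
  · rw [hJ.normSEU_inclAct, hJ'.normSEU_inclAct, hg1, Profile.normSEU_constAct, hb]

/-- Both comparisons are transferred to the same fresh outcomes with the same normalized values;
only beliefs differ there, and belief irrelevance removes that difference. -/
theorem rel_iff_of_normSEU_eq [NeZero n] [Infinite O] (hP : R.ParetoPrinciple) (hI : R.IIE)
    (hB : R.BeliefIrrelevance) {X' : FeasibleSet O} (P : Profile n Ω X) (P' : Profile n Ω X')
    {f g : Act Ω X} {f' g' : Act Ω X'} (hf : ∀ i, P.normSEU i f = P'.normSEU i f')
    (hg : ∀ i, P.normSEU i g = P'.normSEU i g') : R.rel P f g ↔ R.rel P' f' g' := by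
  obtain ⟨S, hS, hSr⟩ := rel_iff_rel_const hP hI P f g
  obtain ⟨S', hS', hSr'⟩ := rel_iff_rel_const hP hI P' f' g'
  have hinf : (S ∪ S')ᶜ.Infinite := (hS.union hS').infinite_compl
  let e := hinf.natEmbedding
  let z : Fin 4 → O := fun k => (e k).1
  have hz : Function.Injective z := fun k l h => Fin.ext (e.injective (Subtype.ext h))
  -- Two outcomes carry the utility vectors to be compared; the other two, unanimously best and
  -- worst, make the values normalized.
  let Z : FeasibleSet O := ⟨Set.range z, Set.countable_range z,
    ⟨z 0, ⟨0, rfl⟩, z 1, ⟨1, rfl⟩, hz.ne (by decide)⟩⟩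
  let x : Fin 4 ≃ Z.carrier := Equiv.ofInjective z hz
  have hSZ : Disjoint S Z.carrier := by
    rw [Set.disjoint_right]
    rintro _ ⟨k, rfl⟩ hk
    exact (e k).2 (Or.inl hk)
  have hSZ' : Disjoint S' Z.carrier := by
    rw [Set.disjoint_right]
    rintro _ ⟨k, rfl⟩ hk
    exact (e k).2 (Or.inr hk)
  let w : Fin n → Z.carrier → ℝ := fun i y => ![P.normSEU i f, P.normSEU i g, 1, 0] (x.symm y)
  have hx : ∀ i k, w i (x k) = ![P.normSEU i f, P.normSEU i g, 1, 0] k := fun i k => by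
    simp only [w, Equiv.symm_apply_apply]
  have hfm := P.normSEU_mem_Icc f
  have hgm := P.normSEU_mem_Icc g
  have hN : ∀ i, IsNormalized (w i) := by
    intro i
    have hmem : ∀ y, w i y ∈ Set.Icc (0 : ℝ) 1 := by
      intro y
      obtain ⟨k, rfl⟩ := x.surjective y
      rw [hx]
      fin_cases k
      exacts [⟨hfm.1 i, hfm.2 i⟩, ⟨hgm.1 i, hgm.2 i⟩, ⟨zero_le_one, le_rfl⟩,
        ⟨le_rfl, zero_le_one⟩]
    exact ⟨fun y => (hmem y).1, fun y => (hmem y).2, ⟨x 2, hx i 2⟩, ⟨x 3, hx i 3⟩⟩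
  rw [hSr Z (Profile.ofNormalized w P.belief hN (fun i => inferInstance) P.nonatomic_belief)
      (x 0) (x 1) hSZ (fun i => (Profile.belief_ofNormalized i).symm)
      (fun i => by rw [Profile.normValue_ofNormalized]; exact hx i 0)
      (fun i => by rw [Profile.normValue_ofNormalized]; exact hx i 1),
    hSr' Z (Profile.ofNormalized w P'.belief hN (fun i => inferInstance) P'.nonatomic_belief)
      (x 0) (x 1) hSZ' (fun i => (Profile.belief_ofNormalized i).symm)
      (fun i => by rw [Profile.normValue_ofNormalized, ← hf]; exact hx i 0)
      (fun i => by rw [Profile.normValue_ofNormalized, ← hg]; exact hx i 1)]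
  exact hB Z _ _ (fun i y => by simp only [Profile.normValue_ofNormalized]) _ _

theorem rel_iff_socialOrder [NeZero n] [Infinite O] (hP : R.ParetoPrinciple) (hI : R.IIE)
    (hB : R.BeliefIrrelevance) (P : Profile n Ω X) (f g : Act Ω X) :
    R.rel P f g ↔ R.socialOrder (fun i => P.normSEU i f) (fun i => P.normSEU i g) := by
  refine ⟨fun h => ⟨X, P, f, g, rfl, rfl, h⟩, ?_⟩
  rintro ⟨X', P', f', g', hf, hg, h⟩
  exact (rel_iff_of_normSEU_eq hP hI hB P' P (congrFun hf) (congrFun hg)).1 h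

end AggRule

end FairAgg

/-! ### Translating the axioms to the order on utility vectors -/

namespace FairAgg

variable {n : ℕ} {Ω : Type*} [MeasurableSpace Ω] {O : Type*} {X : FeasibleSet O}

open Classical in
theorem measureReal_preimage_singleton_eq_integral {p : Measure Ω} [IsFiniteMeasure p]
    (f : Act Ω X) (y : X.carrier) :
    p.real (f ⁻¹' {y}) = ∫ ω, (fun x => if x = y then (1 : ℝ) else 0) (f ω) ∂p := by
  rw [integral_comp_act_eq_sum (fun x => if x = y then (1 : ℝ) else 0) f (insert y f.range)
    (Finset.subset_insert _ _)]
  simp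

/-- Given an event partition into cells that are almost sure for one individual each, acts that are
constant on the cells can be mixed with any outcome. -/
theorem Profile.exists_isPseudoMix (P : Profile n Ω X) (κ : SimpleFunc Ω (Fin n))
    (hκ : ∀ i, ∀ᵐ ω ∂(P.belief i), κ ω = i) {α : ℝ} (h0 : 0 ≤ α) (h1 : α ≤ 1)
    (a : Fin n → X.carrier) (x : X.carrier) :
    ∃ g : Act Ω X, P.IsPseudoMix (κ.map a) x α g := by
  classical
  have hone : ∀ i, (P.belief i).real (κ ⁻¹' {i}) = 1 := by
    intro i
    rw [← probReal_univ (μ := P.belief i)]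
    exact measureReal_congr (eventuallyEq_univ.2 (hκ i))
  choose A hAκ hA hAp using fun i => (P.nonatomic_belief i).exists_subset_measureReal_eq
    (κ.measurableSet_fiber i) h0 (h1.trans_eq (hone i).symm)
  have hU : MeasurableSet (⋃ i, A i) := MeasurableSet.iUnion hA
  refine ⟨SimpleFunc.piecewise _ hU (κ.map a) (constAct Ω x), fun i y => ?_⟩
  -- Individual `i` regards the other cells as null, so the union counts only through `A i`.
  have hUA : (P.belief i).real (⋃ i, A i) = α := by
    rw [← hAp i]
    refine measureReal_congr ?_
    filter_upwards [hκ i] with ω hω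
    refine propext ⟨fun h => ?_, fun h => Set.mem_iUnion_of_mem i h⟩
    obtain ⟨j, hj⟩ := Set.mem_iUnion.1 h
    have hij : κ ω = j := hAκ j hj
    rw [hω] at hij
    rwa [← hij] at hj
  have e1 : (P.belief i).real (SimpleFunc.piecewise _ hU (κ.map a) (constAct Ω x) ⁻¹' {y}) =
      (P.belief i).real (betAct (a i) x _ hU ⁻¹' {y}) := by
    rw [measureReal_preimage_singleton_eq_integral, measureReal_preimage_singleton_eq_integral]
    refine integral_congr_ae ?_
    filter_upwards [hκ i] with ω hω
    by_cases h : ω ∈ ⋃ i, A i <;> simp only [betAct, SimpleFunc.piecewise_apply, h, if_true,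
      if_false, SimpleFunc.map_apply, hω, SimpleFunc.const_apply]
  have e2 : (P.belief i).real (κ.map a ⁻¹' {y}) = if a i = y then 1 else 0 := by
    rw [measureReal_preimage_singleton_eq_integral,
      integral_congr_ae (g := fun _ => if a i = y then (1 : ℝ) else 0)]
    · simp
    · filter_upwards [hκ i] with ω hω
      simp only [SimpleFunc.map_apply, hω]
  rw [e1, e2, measureReal_preimage_singleton_eq_integral,
    integral_comp_betAct (fun x => if x = y then (1 : ℝ) else 0), hUA]
  by_cases hxy : y = x
  · simp [hxy]
  · simp [hxy, Ne.symm hxy]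

theorem Profile.normSEU_map_partition (P : Profile n Ω X) (κ : SimpleFunc Ω (Fin n))
    (hκ : ∀ i, ∀ᵐ ω ∂(P.belief i), κ ω = i) (a : Fin n → X.carrier) (i : Fin n) :
    P.normSEU i (κ.map a) = P.normValue i (a i) := by
  rw [normSEU, integral_congr_ae (g := fun _ => P.normValue i (a i))]
  · simp
  · filter_upwards [hκ i] with ω hω
    simp only [SimpleFunc.map_apply, hω]

namespace AggRule

variable {R : AggRule n Ω O} [NeZero n] [Infinite O] {p : Measure Ω}

/-- Each coordinate of `u` and `v` becomes the common value of an outcome. Paying individual `i`'s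
outcome on a cell that only `i` deems possible realizes both vectors with identical value functions.
-/
theorem socialOrder_certainty (hP : R.ParetoPrinciple) (hI : R.IIE) (hB : R.BeliefIrrelevance)
    (hC : R.RestrictedCertaintyIndependence) (hp : IsProbabilityMeasure p) (hna : Nonatomic p)
    {u v : Fin n → ℝ} (hu : u ∈ Set.Icc 0 1) (hv : v ∈ Set.Icc 0 1) {c : ℝ}
    (hc : c ∈ Set.Icc (0 : ℝ) 1) {α : ℝ} (h0 : 0 < α) (h1 : α < 1) :
    R.socialOrder u v ↔
      R.socialOrder (fun i => α * u i + (1 - α) * c) (fun i => α * v i + (1 - α) * c) := by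
  obtain ⟨k, rfl⟩ : ∃ k, n = k + 1 := Nat.exists_eq_succ_of_ne_zero (NeZero.ne n)
  obtain ⟨κ, hκ⟩ := hna.exists_partition k
  let S : Set ℝ := Set.range u ∪ Set.range v ∪ {c, 0, 1}
  have hS : S.Countable :=
    (((Set.finite_range u).union (Set.finite_range v)).union (Set.toFinite _)).countable
  have hS1 : S ⊆ Set.Icc 0 1 := by
    rintro s ((⟨i, rfl⟩ | ⟨i, rfl⟩) | rfl | rfl | rfl)
    exacts [⟨hu.1 i, hu.2 i⟩, ⟨hv.1 i, hv.2 i⟩, hc, ⟨le_rfl, zero_le_one⟩, ⟨zero_le_one, le_rfl⟩]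
  have : Countable S := hS.to_subtype
  obtain ⟨X, P, x, hb, hx⟩ := Profile.exists_realization (n := k + 1) (O := O)
    (fun (s : S) _ => s.1) (fun s => const_mem_cube (hS1 s.2)) ⟨⟨1, by simp [S]⟩, rfl⟩
    ⟨⟨0, by simp [S]⟩, rfl⟩ (fun i => ProbabilityTheory.cond p (κ ⁻¹' {i}))
    (fun i => ProbabilityTheory.cond_isProbabilityMeasure (hκ i).ne')
    fun i => hna.cond (κ.measurableSet_fiber i)
  have hκ' : ∀ i, ∀ᵐ ω ∂(P.belief i), κ ω = i := fun i => by
    rw [hb]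
    exact ProbabilityTheory.ae_cond_mem (κ.measurableSet_fiber i)
  let a : Fin (k + 1) → X.carrier := fun i => x ⟨u i, Or.inl (Or.inl ⟨i, rfl⟩)⟩
  let b : Fin (k + 1) → X.carrier := fun i => x ⟨v i, Or.inl (Or.inr ⟨i, rfl⟩)⟩
  let z : X.carrier := x ⟨c, Or.inr (Or.inl rfl)⟩
  obtain ⟨f', hf'⟩ := P.exists_isPseudoMix κ hκ' h0.le h1.le a z
  obtain ⟨g', hg'⟩ := P.exists_isPseudoMix κ hκ' h0.le h1.le b z
  have hcommon : ∀ i j y, P.normValue i y = P.normValue j y := by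
    intro i j y
    obtain ⟨s, rfl⟩ := x.surjective y
    rw [hx, hx]
  have := hC X P hcommon (κ.map a) (κ.map b) z α h0 h1 f' g' hf' hg'
  rw [rel_iff_socialOrder hP hI hB, rel_iff_socialOrder hP hI hB] at this
  simpa only [hf'.normSEU_eq, hg'.normSEU_eq, P.normSEU_map_partition κ hκ', a, b, z, hx] using this

theorem isMaxminOrder_socialOrder (hP : R.ParetoPrinciple) (hcont : R.Continuity) (hI : R.IIE)
    (hW : R.WeakPreferenceForMixing) (hB : R.BeliefIrrelevance)
    (hC : R.RestrictedCertaintyIndependence) (hp : IsProbabilityMeasure p) (hna : Nonatomic p) :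
    IsMaxminOrder R.socialOrder := by
  have hrel := fun {X : FeasibleSet O} => rel_iff_socialOrder (X := X) hP hI hB
  refine ⟨fun u hu v hv => ?_, fun u hu v hv w hw huv hvw => ?_, fun u hu v hv h => ?_,
    fun u hu v hv h => ?_, fun u hu v hv F hF hlim h => ?_, fun u hu v hv F hF hlim h => ?_,
    fun u hu v hv => ?_, fun u hu v hv c hc α h0 h1 =>
      socialOrder_certainty hP hI hB hC hp hna hu hv hc h0 h1⟩
  · obtain ⟨X, P, x, -, hx⟩ := Profile.exists_realization_set (O := O) (S := {u, v})
      (Set.toFinite _).countable (by rintro _ (rfl | rfl) <;> assumption) hp hna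
    have := R.complete P (constAct Ω (x ⟨u, by simp⟩)) (constAct Ω (x ⟨v, by simp⟩))
    simpa only [hrel, Profile.normSEU_constAct, hx] using this
  · obtain ⟨X, P, x, -, hx⟩ := Profile.exists_realization_set (O := O) (S := {u, v, w})
      (Set.toFinite _).countable (by rintro _ (rfl | rfl | rfl) <;> assumption) hp hna
    have := R.transitive P (constAct Ω (x ⟨u, by simp⟩)) (constAct Ω (x ⟨v, by simp⟩))
      (constAct Ω (x ⟨w, by simp⟩))
    simp only [hrel, Profile.normSEU_constAct, hx] at this
    exact this huv hvw
  · obtain ⟨X, P, x, -, hx⟩ := Profile.exists_realization_set (O := O) (S := {u, v})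
      (Set.toFinite _).countable (by rintro _ (rfl | rfl) <;> assumption) hp hna
    have := (hP X P (constAct Ω (x ⟨u, by simp⟩)) (constAct Ω (x ⟨v, by simp⟩))).1
    simp only [hrel, P.pref_iff, Profile.normSEU_constAct, hx] at this
    exact this h
  · obtain ⟨X, P, x, -, hx⟩ := Profile.exists_realization_set (O := O) (S := {u, v})
      (Set.toFinite _).countable (by rintro _ (rfl | rfl) <;> assumption) hp hna
    have := (hP X P (constAct Ω (x ⟨u, by simp⟩)) (constAct Ω (x ⟨v, by simp⟩))).2
    simp only [hrel, P.pref_iff, Profile.normSEU_constAct, hx] at this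
    exact (this fun i => ⟨(h i).le, (h i).not_ge⟩).2
  -- The limit and the whole sequence must be outcomes of one problem; here countably infinite
  -- feasible sets are used.
  · obtain ⟨X, P, x, -, hx⟩ := Profile.exists_realization_set (O := O) (S := {u, v} ∪ Set.range F)
      ((Set.toFinite _).countable.union (Set.countable_range F))
      (by rintro _ ((rfl | rfl) | ⟨t, rfl⟩); exacts [hu, hv, hF t]) hp hna
    have := (hcont X P (constAct Ω (x ⟨u, by simp⟩)) (constAct Ω (x ⟨v, by simp⟩))
      fun t => constAct Ω (x ⟨F t, Or.inr ⟨t, rfl⟩⟩))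
    simp only [hrel, Profile.normSEU_constAct, hx] at this
    exact (this hlim).1 h
  · obtain ⟨X, P, x, -, hx⟩ := Profile.exists_realization_set (O := O) (S := {u, v} ∪ Set.range F)
      ((Set.toFinite _).countable.union (Set.countable_range F))
      (by rintro _ ((rfl | rfl) | ⟨t, rfl⟩); exacts [hu, hv, hF t]) hp hna
    have := (hcont X P (constAct Ω (x ⟨u, by simp⟩)) (constAct Ω (x ⟨v, by simp⟩))
      fun t => constAct Ω (x ⟨F t, Or.inr ⟨t, rfl⟩⟩))
    simp only [hrel, Profile.normSEU_constAct, hx] at this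
    exact (this hlim).2 h
  · obtain ⟨X, P, x, hb, hx⟩ := Profile.exists_realization_set (O := O) (S := {u, v})
      (Set.toFinite _).countable (by rintro _ (rfl | rfl) <;> assumption) hp hna
    -- Beliefs are common in this realization, so one event serves as a coin toss for everyone.
    obtain ⟨E, -, hE, hEp⟩ := hna.exists_subset_measureReal_eq MeasurableSet.univ
      (by norm_num : (0 : ℝ) ≤ 1 / 2) (by rw [probReal_univ]; norm_num)
    have hcoin : P.IsCoinToss E := fun i => by rw [hb, hEp]
    have := hW X P (x ⟨u, by simp⟩) (x ⟨v, by simp⟩) E hE hcoin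
    simpa only [hrel, Profile.normSEU_constAct, Profile.normSEU_betAct, hcoin _, hx] using this

theorem socialOrder_perm (hP : R.ParetoPrinciple) (hI : R.IIE) (hB : R.BeliefIrrelevance)
    (hA : R.Anonymity) (π : Equiv.Perm (Fin n)) {u v : Fin n → ℝ} (h : R.socialOrder u v) :
    R.socialOrder (fun i => u (π i)) (fun i => v (π i)) := by
  obtain ⟨X, P, f, g, rfl, rfl, h⟩ := h
  rw [hA X P π, rel_iff_socialOrder hP hI hB] at h
  exact h

theorem exists_isRelativeFair (hP : R.ParetoPrinciple) (hcont : R.Continuity) (hI : R.IIE)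
    (hW : R.WeakPreferenceForMixing) (hB : R.BeliefIrrelevance)
    (hC : R.RestrictedCertaintyIndependence) (hA : R.Anonymity) :
    ∃ M : Set (Fin n → ℝ), IsRelativeFair R M ∧ SymmetricWeights M := by
  by_cases hex : ∃ p : Measure Ω, IsProbabilityMeasure p ∧ Nonatomic p
  · obtain ⟨p, hp, hna⟩ := hex
    have hQ := isMaxminOrder_socialOrder hP hcont hI hW hB hC hp hna
    refine ⟨IsMaxminOrder.weights R.socialOrder, ⟨Set.inter_subset_left, ?_,
      IsMaxminOrder.isClosed_weights, IsMaxminOrder.convex_weights, fun X P f g => ?_⟩,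
      hQ.symmetricWeights fun u _ v _ π => socialOrder_perm hP hI hB hA π⟩
    · obtain ⟨μ, hμ, -⟩ := hQ.exists_mem_weights (const_mem_cube (n := n) ⟨le_rfl, zero_le_one⟩)
      exact ⟨μ, hμ⟩
    · rw [rel_iff_socialOrder hP hI hB, hQ.rel_iff (P.normSEU_mem_Icc f) (P.normSEU_mem_Icc g),
        hQ.minWeighted_weights (P.normSEU_mem_Icc f), hQ.minWeighted_weights (P.normSEU_mem_Icc g)]
  -- Without a nonatomic probability measure there are no profiles, and any admissible weight set
  -- works.
  · refine ⟨stdSimplex ℝ (Fin n), ⟨subset_rfl, ⟨_, single_mem_stdSimplex ℝ 0⟩,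
      isClosed_stdSimplex ℝ (Fin n), convex_stdSimplex ℝ (Fin n), fun X P f g => ?_⟩,
      fun μ hμ π => ⟨fun i => hμ.1 _, (Equiv.sum_comp π μ).trans hμ.2⟩⟩
    exact absurd ⟨P.belief 0, inferInstance, P.nonatomic_belief 0⟩ hex

end AggRule

end FairAgg

theorem mainTheorem7 (n : ℕ) (hn : 2 ≤ n) (Ω : Type*) [MeasurableSpace Ω] [Infinite Ω]
    (O : Type*) [Infinite O] (R : FairAgg.AggRule n Ω O) :
    (R.ParetoPrinciple ∧ R.Continuity ∧ R.IIE ∧ R.WeakPreferenceForMixing ∧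
      R.BeliefIrrelevance ∧ R.RestrictedCertaintyIndependence ∧ R.Anonymity) ↔
    ∃ M : Set (Fin n → ℝ), FairAgg.IsRelativeFair R M ∧ FairAgg.SymmetricWeights M := by
  have : NeZero n := ⟨by omega⟩
  constructor
  · rintro ⟨hP, hcont, hI, hW, hB, hC, hA⟩
    exact FairAgg.AggRule.exists_isRelativeFair hP hcont hI hW hB hC hA
  · rintro ⟨M, hM, hs⟩
    exact ⟨hM.paretoPrinciple, hM.continuity, hM.iie, hM.weakPreferenceForMixing,
      hM.beliefIrrelevance, hM.restrictedCertaintyIndependence, hM.anonymity hs⟩
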